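/- Let $G=(V,E)$ be a finite simple graph with $n=|V|$. A neighbor assignment function (NAF) of $G$ is a map $f:V\to V$ with $\{v,f(v)\}\in E$ for all $v$; its (maximum) load is $\max_w |f^{-1}(w)|$. Radio network model. The vertices are processors with unique IDs. In each timestep every node sleeps, listens, or sends a message. A listening node receives a message if and only if exactly one of its neighbors sends, and otherwise it receives nothing (no collision detection). Sending and listening cost one unit of energy each, sleeping is free. Maximal matching algorithm, with constant $C>0$. Let $t_{\max}=C\,n\log n$ and $r(t)=\dfrac{3C\log n}{4C\log n+t_{\max}-t}$. Every node starts with no partner. In each round $t=1,2,\dots$ with $t\le t_{\max}$ (three timesteps per round), every node without a partner samples $x$ uniformly from $[0,1]$, independently; it recruits if $x\le r(t)/2$, accepts if $r(t)/2<x\le r(t)$, and sleeps otherwise. Nodes that have a partner sleep. Timestep 1: a recruiter $u$ sends its ID $u$, accepters listen. Timestep 2: recruiters listen; an accepter $w$ that received an ID $u$ sends $(u,w)$, other accepters sleep. Timestep 3: a recruiter $u$ that received a pair $(u,w)$ with its own ID first sets its partner to $w$ and sends $(u,w)$, other recruiters sleep; an accepter $w$ that received a message in timestep 1 listens, and if it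 receives a pair $(u,w)$ with its own ID second, it sets its partner to $u$; other accepters sleep. Algorithm NAF, with parameter $k$. Run the maximal matching algorithm; mark the two endpoints of every edge of the resulting matching as assigned, and assign them to each other. Then repeat $k$ times: run the maximal matching algorithm from scratch with fresh randomness, modified so that only nodes unassigned before this run may recruit and only nodes assigned before this run may accept (a node that samples a role it may not play sleeps in that round); afterwards mark the endpoints of every edge of the resulting matching as assigned and (re-)assign them to each other. The output is the final assignment. Theorem. There is an absolute constant $d$ such that for every $c>0$ there is $C_0>0$ such that for every $C\ge C_0$ and every $b$ there is $B$, depending only on $c,C,b$, with the following property. If $G$ is a finite graph on $n$ vertices that has a NAF of load $L$, and $k$ is an integer with $2L\log n\le k\le b\,L\log n$, then with probability at least $1-n^{-c}$, Algorithm NAF run on $G$ with parameter $k$ and with constant $C$ in the matching algorithm outputs a NAF of load at most $B\,L\log n$, and every node uses at most $B\,L\,(\log n)^{d}$ units of energy in total. Here $\log$ is the natural logarithm. -/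

import Mathlib

open MeasureTheory

/-! ### Radio networks without collision detection -/

/-- What a node does in one timestep; `M` is the type of messages. -/
inductive RadioAction (M : Type*) where
  | sleep : RadioAction M
  | listen : RadioAction M
  | send (m : M) : RadioAction M

/-- Sending and listening cost one unit of energy, sleeping is free. -/
def RadioAction.cost {M : Type*} : RadioAction M → ℕ
  | .sleep => 0
  | .listen => 1
  | .send _ => 1

/-- When the nodes perform the actions `a` in a timestep, node `v` hears the message `m`: `v` listens,
a neighbor `u` of `v` sends `m`, and no other neighbor of `v` sends. -/
def Hears {V M : Type*} (G : SimpleGraph V) (a : V → RadioAction M) (v : V) (m : M) : Prop :=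
  a v = .listen ∧
    ∃ u, G.Adj v u ∧ a u = .send m ∧ ∀ w, G.Adj v w → (∃ m', a w = .send m') → w = u

theorem Hears.unique {V M : Type*} {G : SimpleGraph V} {a : V → RadioAction M} {v : V} {m m' : M}
    (h : Hears G a v m) (h' : Hears G a v m') : m = m' := by
  obtain ⟨-, u, hu, hum, hu'⟩ := h
  obtain ⟨-, w, hw, hwm, -⟩ := h'
  have : w = u := hu' w hw ⟨m', hwm⟩
  subst this
  rw [hum] at hwm
  exact RadioAction.send.inj hwm

open Classical in
/-- The message received by `v`, if any. Silence and collision both give `none`. -/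
noncomputable def received {V M : Type*} (G : SimpleGraph V) (a : V → RadioAction M) (v : V) :
    Option M :=
  if h : ∃ m, Hears G a v m then some h.choose else none

theorem received_eq_some_iff {V M : Type*} {G : SimpleGraph V} {a : V → RadioAction M} {v : V}
    {m : M} : received G a v = some m ↔ Hears G a v m := by
  unfold received
  constructor
  · intro h
    split_ifs at h with hex
    rw [← Option.some.inj h]
    exact hex.choose_spec
  · intro h
    have hex : ∃ m, Hears G a v m := ⟨m, h⟩
    rw [dif_pos hex]
    exact congrArg some (hex.choose_spec.unique h)

/-! ### One round of the matching protocol (three timesteps)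

All functions up to `newPartner` are local: they depend only on the ID `me` of the node, on the role
it has chosen, and on what it has received so far in the round. The vertices serve as the IDs. -/

/-- The role of a node in a round. -/
inductive Role where
  | recruit : Role
  | accept : Role
  | sleep : Role

/-- Timestep 1: a recruiter sends its ID, an accepter listens. -/
def firstAction {V : Type*} (me : V) : Role → RadioAction V
  | .recruit => .send me
  | .accept => .listen
  | .sleep => .sleep

/-- Timestep 2: a recruiter listens; an accepter that received `x` sends `(x, me)`. -/
def secondAction {V : Type*} (me : V) : Role → Option V → RadioAction (V × V)
  | .recruit, _ => .listen
  | .accept, some x => .send (x, me)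
  | .accept, none => .sleep
  | .sleep, _ => .sleep

/-- Timestep 3: a recruiter that received a pair `(x, y)` with `x = me` repeats it; an accepter that
received a message in timestep 1 listens. `m₁`, `m₂` are what the node received in timesteps 1, 2. -/
def thirdAction {V : Type*} [DecidableEq V] (me : V) (role : Role) (m₁ : Option V)
    (m₂ : Option (V × V)) : RadioAction (V × V) :=
  match role, m₁, m₂ with
  | .recruit, _, some (x, y) => if x = me then .send (x, y) else .sleep
  | .recruit, _, none => .sleep
  | .accept, some _, _ => .listen
  | .accept, none, _ => .sleep
  | .sleep, _, _ => .sleep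

/-- The partner that a node acquires in a round, from what it received in timesteps 2 and 3. -/
def newPartner {V : Type*} [DecidableEq V] (me : V) (role : Role) (m₂ m₃ : Option (V × V)) :
    Option V :=
  match role, m₂, m₃ with
  | .recruit, some (x, y), _ => if x = me then some y else none
  | .accept, _, some (x, y) => if y = me then some x else none
  | _, _, _ => none

/-- The variables `partner` of all nodes, and the energy every node has spent. -/
structure MatchState (V : Type*) where
  partner : V → Option V
  energy : V → ℕ

/-- One round, when the nodes have chosen the roles `role`. -/
noncomputable def matchRound {V : Type*} [DecidableEq V] (G : SimpleGraph V) (role : V → Role)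
    (s : MatchState V) : MatchState V :=
  let a₁ : V → RadioAction V := fun v => firstAction v (role v)
  let m₁ := received G a₁
  let a₂ : V → RadioAction (V × V) := fun v => secondAction v (role v) (m₁ v)
  let m₂ := received G a₂
  let a₃ : V → RadioAction (V × V) := fun v => thirdAction v (role v) (m₁ v) (m₂ v)
  let m₃ := received G a₃
  { partner := fun v => (newPartner v (role v) (m₂ v) (m₃ v)).or (s.partner v)
    energy := fun v => s.energy v + ((a₁ v).cost + (a₂ v).cost + (a₃ v).cost) }

/-! ### The (restricted) maximal matching algorithm -/

/-- The real number `t_max = C n log n`. -/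
noncomputable def tMax (C : ℝ) (n : ℕ) : ℝ := C * n * Real.log n

/-- The participation rate in round `t`. -/
noncomputable def rate (C : ℝ) (n t : ℕ) : ℝ :=
  3 * C * Real.log n / (4 * C * Real.log n + tMax C n - t)

/-- The role chosen by a node whose random sample is `x`, at participation rate `r`. A node that
already has a partner sleeps, and a node sleeps instead of playing a role it is not allowed to play. -/
noncomputable def chooseRole {V : Type*} (mayRecruit mayAccept : Bool) (r x : ℝ)
    (partner : Option V) : Role :=
  if partner.isSome then .sleep
  else if x ≤ r / 2 then (if mayRecruit then .recruit else .sleep)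
  else if x ≤ r then (if mayAccept then .accept else .sleep)
  else .sleep

/-- The state after `t` rounds; `x t v` is the sample of node `v` in round `t = 1, 2, …`. -/
noncomputable def matchRounds {V : Type*} [Fintype V] [DecidableEq V] (G : SimpleGraph V) (C : ℝ)
    (mayRecruit mayAccept : V → Bool) (x : ℕ → V → ℝ) : ℕ → MatchState V
  | 0 => { partner := fun _ => none, energy := fun _ => 0 }
  | t + 1 =>
    let s := matchRounds G C mayRecruit mayAccept x t
    matchRound G
      (fun v => chooseRole (mayRecruit v) (mayAccept v) (rate C (Fintype.card V) (t + 1))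
        (x (t + 1) v) (s.partner v)) s

/-- A complete run: all rounds `t` with `1 ≤ t ≤ t_max`. -/
noncomputable def matchingAlg {V : Type*} [Fintype V] [DecidableEq V] (G : SimpleGraph V) (C : ℝ)
    (mayRecruit mayAccept : V → Bool) (x : ℕ → V → ℝ) : MatchState V :=
  matchRounds G C mayRecruit mayAccept x ⌊tMax C (Fintype.card V)⌋₊

/-! ### Neighbor assignment functions, and the algorithm that computes one -/

/-- `f` is a neighbor assignment function of `G`. -/
def IsNAF {V : Type*} (G : SimpleGraph V) (f : V → V) : Prop := ∀ v, G.Adj v (f v)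

/-- The (maximum) load `max_w |f⁻¹(w)|`. -/
def load {V : Type*} [Fintype V] [DecidableEq V] (f : V → V) : ℕ :=
  Finset.univ.sup fun w => (Finset.univ.filter fun v => f v = w).card

/-- The neighbor currently assigned to every node (`none`: the node is unassigned), and the energy
every node has spent. -/
structure NAFState (V : Type*) where
  assign : V → Option V
  energy : V → ℕ

/-- The nodes matched by a run of the matching algorithm are (re-)assigned to their partners. -/
def NAFState.update {V : Type*} (s : NAFState V) (m : MatchState V) : NAFState V where
  assign v := (m.partner v).or (s.assign v)
  energy v := s.energy v + m.energy v

/-- The algorithm with parameter `k`; `x i t v` is the sample of node `v` in round `t` of the `i`-th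
run of the matching algorithm. The run `i = 0` is unrestricted; in the runs `i = 1, …, k` only nodes
unassigned before the run may recruit, and only nodes assigned before the run may accept. -/
noncomputable def nafAlg {V : Type*} [Fintype V] [DecidableEq V] (G : SimpleGraph V) (C : ℝ)
    (x : ℕ → ℕ → V → ℝ) : (k : ℕ) → NAFState V
  | 0 =>
    NAFState.update { assign := fun _ => none, energy := fun _ => 0 }
      (matchingAlg G C (fun _ => true) (fun _ => true) (x 0))
  | i + 1 =>
    let s := nafAlg G C x i
    s.update
      (matchingAlg G C (fun v => (s.assign v).isNone) (fun v => (s.assign v).isSome) (x (i + 1)))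

/-- The law of the random samples: independent and uniform on `[0, 1]`, one for every run `i`,
round `t` and node `v`. -/
noncomputable def sampleLaw (V : Type*) : Measure (ℕ × ℕ × V → unitInterval) :=
  Measure.infinitePi fun _ => (volume : Measure unitInterval)

/-- The state of the network at the end of the algorithm with parameter `k`, as a function of the
random samples. -/
noncomputable def nafOutput {V : Type*} [Fintype V] [DecidableEq V] (G : SimpleGraph V) (C : ℝ)
    (k : ℕ) (ω : ℕ × ℕ × V → unitInterval) : NAFState V :=
  nafAlg G C (fun i t v => (ω (i, t, v) : ℝ)) k

/-! The proof combines a deterministic counting argument with a bound on the probability that a run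
fails to be maximal. Suppose that no run leaves an edge that it could add. After run 0 no two
adjacent nodes are both unassigned, so `f v` is assigned whenever `v` is not. In a later run, either
such a `v` is matched, or `f v` is matched to a newly assigned `u`, and each `u` accounts for at
most `L` nodes `v`. So each run assigns at least a fraction 1/(L+1) of the unassigned nodes
(`card_unassigned_succ`), and `2 L log n` runs assign all of them
(`assignAfter_ne_none_of_allMaximal`). Each run is a matching and adds at most one node to each
preimage, so the load is at most `k + 1` (`card_assignAfter_eq_le`).

A run is maximal with high probability because its rate tracks the degrees. While the open degrees
are at most M and the rate is of order 1/M, a node with at least M/2 open neighbors is matched in a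
round with probability at least of order 1/M: the events that it meets a given neighbor without
competition are disjoint (`measureReal_recruiter_stays_le`, `measureReal_accepter_stays_le`). Of
order M log n rounds are spent at this rate, so the degree bound is halved except with polynomially
small probability (`measureReal_phase_fails_le`). After about log₂ n halvings no open edge is left
(`measureReal_not_isMaximalRun_le`). This bound is uniform in the restrictions, and the restrictions
of a run depend only on earlier, independent runs, so a union bound covers all runs
(`measureReal_not_allMaximal_le`).

The energy of a node is at most three times the number of rounds in which it samples a role other
than sleep, a sum of independent indicators. The rates of one run sum to O(log² n) (`sum_rate_le`),
and a Chernoff bound (`measureReal_awake_ge_le`) over `k + 1` runs gives O(L log³ n), hence `d = 3`.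
-/

/-! ### What the nodes hear in a round -/

section Round

variable {V : Type*} (G : SimpleGraph V) (role : V → Role)

/-- What the nodes hear in timestep 1. -/
noncomputable def firstHeard : V → Option V :=
  received G fun v => firstAction v (role v)

/-- What the nodes hear in timestep 2. -/
noncomputable def secondHeard : V → Option (V × V) :=
  received G fun v => secondAction v (role v) (firstHeard G role v)

/-- What the nodes hear in timestep 3. -/
noncomputable def thirdHeard [DecidableEq V] : V → Option (V × V) :=
  received G fun v => thirdAction v (role v) (firstHeard G role v) (secondHeard G role v)

/-- The partner that a node acquires in a round. -/
noncomputable def roundPartner [DecidableEq V] (v : V) : Option V :=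
  newPartner v (role v) (secondHeard G role v) (thirdHeard G role v)

theorem matchRound_partner [DecidableEq V] (s : MatchState V) (v : V) :
    (matchRound G role s).partner v = (roundPartner G role v).or (s.partner v) := rfl

theorem firstAction_eq_send {v u : V} {ρ : Role} :
    firstAction v ρ = .send u ↔ ρ = .recruit ∧ u = v := by
  cases ρ <;> simp [firstAction, eq_comm]

theorem firstAction_eq_listen {v : V} {ρ : Role} :
    firstAction v ρ = .listen ↔ ρ = .accept := by
  cases ρ <;> simp [firstAction]

theorem secondAction_eq_send {v : V} {ρ : Role} {m : Option V} {p : V × V} :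
    secondAction v ρ m = .send p ↔ ρ = .accept ∧ ∃ x, m = some x ∧ p = (x, v) := by
  cases ρ <;> cases m <;> simp [secondAction, eq_comm]

theorem secondAction_eq_listen {v : V} {ρ : Role} {m : Option V} :
    secondAction v ρ m = .listen ↔ ρ = .recruit := by
  cases ρ <;> cases m <;> simp [secondAction]

theorem thirdAction_eq_send [DecidableEq V] {v : V} {ρ : Role} {m₁ : Option V}
    {m₂ : Option (V × V)} {p : V × V} :
    thirdAction v ρ m₁ m₂ = .send p ↔ ρ = .recruit ∧ m₂ = some p ∧ p.1 = v := by
  obtain ⟨x, y⟩ := p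
  rcases m₂ with _ | ⟨x', y'⟩ <;> cases ρ <;> cases m₁ <;> simp [thirdAction] <;>
    split_ifs <;> simp_all <;> grind

theorem thirdAction_eq_listen [DecidableEq V] {v : V} {ρ : Role} {m₁ : Option V}
    {m₂ : Option (V × V)} :
    thirdAction v ρ m₁ m₂ = .listen ↔ ρ = .accept ∧ ∃ x, m₁ = some x := by
  rcases m₂ with _ | ⟨x', y'⟩ <;> cases ρ <;> cases m₁ <;> simp [thirdAction] <;>
    split_ifs <;> simp_all

theorem firstHeard_eq_some {v u : V} :
    firstHeard G role v = some u ↔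
      role v = .accept ∧ G.Adj v u ∧ role u = .recruit ∧
        ∀ w, G.Adj v w → role w = .recruit → w = u := by
  rw [firstHeard, received_eq_some_iff, Hears]
  simp only [firstAction_eq_listen, firstAction_eq_send]
  constructor
  · rintro ⟨h, u', hu', ⟨hr, rfl⟩, huniq⟩
    exact ⟨h, hu', hr, fun w hw hwr => huniq w hw ⟨w, hwr, rfl⟩⟩
  · rintro ⟨h, hu, hr, huniq⟩
    exact ⟨h, u, hu, ⟨hr, rfl⟩, fun w hw ⟨_, hwr, _⟩ => huniq w hw hwr⟩

variable {G role}

/-- An accepter that heard anything in timestep 1 has exactly one recruiting neighbor. A recruiter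
that hears it must be that neighbor, so the pair it hears always carries its own ID. -/
theorem secondHeard_spec {v : V} {p : V × V} (h : secondHeard G role v = some p) :
    role v = .recruit ∧ p.1 = v ∧ G.Adj v p.2 ∧ firstHeard G role p.2 = some v := by
  rw [secondHeard, received_eq_some_iff, Hears] at h
  simp only [secondAction_eq_listen, secondAction_eq_send] at h
  obtain ⟨hv, w, hw, ⟨-, x, hx, rfl⟩, -⟩ := h
  have hx' := (firstHeard_eq_some G role).1 hx
  have : v = x := hx'.2.2.2 v hw.symm hv
  subst this
  exact ⟨hv, rfl, hw, hx⟩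

theorem secondHeard_accept {v w : V} (h : secondHeard G role v = some (v, w)) :
    role w = .accept :=
  ((firstHeard_eq_some G role).1 (secondHeard_spec h).2.2.2).1

/-- A recruiter and an accepter that are adjacent and do not compete with other nodes find each
other. -/
theorem secondHeard_of_isolated {u w : V} (hadj : G.Adj u w) (hu : role u = .recruit)
    (hw : role w = .accept) (hua : ∀ z, G.Adj u z → role z = .accept → z = w)
    (hwr : ∀ z, G.Adj w z → role z = .recruit → z = u) :
    secondHeard G role u = some (u, w) := by
  rw [secondHeard, received_eq_some_iff, Hears]
  simp only [secondAction_eq_listen, secondAction_eq_send]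
  refine ⟨hu, w, hadj, ⟨hw, u, ?_, rfl⟩, fun z hz ⟨_, hza, _⟩ => hua z hz hza⟩
  exact (firstHeard_eq_some G role).2 ⟨hw, hadj.symm, hu, hwr⟩

variable [DecidableEq V]

theorem thirdHeard_spec {v : V} {p : V × V} (h : thirdHeard G role v = some p) :
    role v = .accept ∧ ∃ u, firstHeard G role v = some u ∧ secondHeard G role u = some p := by
  rw [thirdHeard, received_eq_some_iff, Hears] at h
  simp only [thirdAction_eq_listen, thirdAction_eq_send] at h
  obtain ⟨⟨hv, x, hx⟩, u, hu, ⟨hur, hup, -⟩, -⟩ := h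
  have : u = x := ((firstHeard_eq_some G role).1 hx).2.2.2 u hu hur
  exact ⟨hv, u, this ▸ hx, hup⟩

/-- The confirmation cannot collide: only recruiters send in timestep 3, and `u` is the only
recruiting neighbor of `v`. -/
theorem thirdHeard_of_secondHeard {v u : V} {p : V × V} (h₁ : firstHeard G role v = some u)
    (h₂ : secondHeard G role u = some p) : thirdHeard G role v = some p := by
  have h₁' := (firstHeard_eq_some G role).1 h₁
  have h₂' := secondHeard_spec h₂
  rw [thirdHeard, received_eq_some_iff, Hears]
  simp only [thirdAction_eq_listen, thirdAction_eq_send]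
  exact ⟨⟨h₁'.1, u, h₁⟩, u, h₁'.2.1, ⟨h₂'.1, h₂, h₂'.2.1⟩,
    fun w hw ⟨_, hwr, _⟩ => h₁'.2.2.2 w hw hwr⟩

/-- Since the confirmation always arrives, the reception of the recruiter in timestep 2 alone
decides whether the edge is matched. This makes the relation symmetric. -/
theorem roundPartner_eq_some {v w : V} :
    roundPartner G role v = some w ↔
      secondHeard G role v = some (v, w) ∨ secondHeard G role w = some (w, v) := by
  rw [roundPartner]
  constructor
  · intro h
    cases hv : role v with
    | sleep => simp [newPartner, hv] at h
    | recruit =>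
      left
      rcases h₂ : secondHeard G role v with _ | ⟨x, y⟩
      · simp [newPartner, hv, h₂] at h
      · have := (secondHeard_spec h₂).2.1
        simp only at this
        subst this
        simpa [newPartner, hv, h₂] using h
    | accept =>
      right
      rcases h₃ : thirdHeard G role v with _ | ⟨x, y⟩
      · simp [newPartner, hv, h₃] at h
      · simp only [newPartner, hv, h₃] at h
        split_ifs at h with hy
        subst hy
        obtain rfl := Option.some.inj h
        obtain ⟨-, u, -, hu⟩ := thirdHeard_spec h₃
        have := (secondHeard_spec hu).2.1
        simp only at this
        rw [this]
        exact this ▸ hu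
  · rintro (h | h)
    · simp [newPartner, (secondHeard_spec h).1, h]
    · have h₁ := (secondHeard_spec h).2.2.2
      simp only at h₁
      have h₃ := thirdHeard_of_secondHeard h₁ h
      simp [newPartner, secondHeard_accept h, h₃]

theorem roundPartner_symm {v w : V} (h : roundPartner G role v = some w) :
    roundPartner G role w = some v :=
  roundPartner_eq_some.2 (roundPartner_eq_some.1 h).symm

theorem roundPartner_adj {v w : V} (h : roundPartner G role v = some w) : G.Adj v w := by
  rcases roundPartner_eq_some.1 h with h | h
  · exact (secondHeard_spec h).2.2.1
  · exact (secondHeard_spec h).2.2.1.symm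

theorem roundPartner_role {v w : V} (h : roundPartner G role v = some w) :
    role v = .recruit ∧ role w = .accept ∨ role v = .accept ∧ role w = .recruit := by
  rcases roundPartner_eq_some.1 h with h | h
  · exact .inl ⟨(secondHeard_spec h).1, secondHeard_accept h⟩
  · exact .inr ⟨secondHeard_accept h, (secondHeard_spec h).1⟩

theorem roundPartner_of_isolated {u w : V} (hadj : G.Adj u w) (hu : role u = .recruit)
    (hw : role w = .accept) (hua : ∀ z, G.Adj u z → role z = .accept → z = w)
    (hwr : ∀ z, G.Adj w z → role z = .recruit → z = u) :
    roundPartner G role u = some w ∧ roundPartner G role w = some u := by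
  have h := secondHeard_of_isolated hadj hu hw hua hwr
  exact ⟨roundPartner_eq_some.2 (.inl h), roundPartner_eq_some.2 (.inr h)⟩

end Round

theorem RadioAction.cost_le_one {M : Type*} (a : RadioAction M) : a.cost ≤ 1 := by
  cases a <;> simp [RadioAction.cost]

open Classical in
theorem matchRound_energy_le {V : Type*} [DecidableEq V] (G : SimpleGraph V) (role : V → Role)
    (s : MatchState V) (v : V) :
    (matchRound G role s).energy v ≤ s.energy v + 3 * (if role v = .sleep then 0 else 1) := by
  unfold matchRound
  simp only
  split_ifs with h
  · simp [h, firstAction, secondAction, thirdAction, RadioAction.cost]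
  · have h1 := RadioAction.cost_le_one (firstAction v (role v))
    have h2 := RadioAction.cost_le_one (secondAction v (role v) (firstHeard G role v))
    have h3 := RadioAction.cost_le_one
      (thirdAction v (role v) (firstHeard G role v) (secondHeard G role v))
    unfold secondHeard firstHeard at *
    omega

/-! ### The matching algorithm as a function of the sampled roles -/

/-- The role sampled by a node, before the restrictions on it are taken into account. -/
noncomputable def drawRole (r x : ℝ) : Role :=
  if x ≤ r / 2 then .recruit else if x ≤ r then .accept else .sleep

/-- The role played by a node with partner `p` that has sampled the role `ρ`. -/
def playedRole {V : Type*} (mayRecruit mayAccept : Bool) (p : Option V) (ρ : Role) : Role :=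
  if p.isSome then .sleep
  else match ρ with
    | .recruit => if mayRecruit then .recruit else .sleep
    | .accept => if mayAccept then .accept else .sleep
    | .sleep => .sleep

/-- This separates randomness from history: the drawn role is a function of the sample alone, hence
independent over rounds and nodes, and all dependence on the past sits in `playedRole`. -/
theorem chooseRole_eq_playedRole {V : Type*} (mR mA : Bool) (r x : ℝ) (p : Option V) :
    chooseRole mR mA r x p = playedRole mR mA p (drawRole r x) := by
  unfold chooseRole playedRole drawRole
  split_ifs <;> simp_all

theorem playedRole_eq_recruit {V : Type*} {mR mA : Bool} {p : Option V} {ρ : Role} :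
    playedRole mR mA p ρ = .recruit ↔ p = none ∧ mR = true ∧ ρ = .recruit := by
  unfold playedRole
  cases p <;> cases ρ <;> cases mR <;> cases mA <;> simp

theorem playedRole_eq_accept {V : Type*} {mR mA : Bool} {p : Option V} {ρ : Role} :
    playedRole mR mA p ρ = .accept ↔ p = none ∧ mA = true ∧ ρ = .accept := by
  unfold playedRole
  cases p <;> cases ρ <;> cases mR <;> cases mA <;> simp

theorem playedRole_sleep {V : Type*} (mR mA : Bool) (p : Option V) :
    playedRole mR mA p .sleep = .sleep := by
  unfold playedRole; split_ifs <;> rfl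

section Matching

variable {V : Type*} [DecidableEq V] (G : SimpleGraph V) (mR mA : V → Bool)

/-- The partners after a round in which the nodes sampled the roles `ρ`, with partners `p` before. -/
noncomputable def stepPartner (p : V → Option V) (ρ : V → Role) (v : V) : Option V :=
  (roundPartner G (fun u => playedRole (mR u) (mA u) (p u) (ρ u)) v).or (p v)

/-- The partners after `t` rounds in which the nodes sampled the roles `δ 1, δ 2, …`. -/
noncomputable def partnerAfter (δ : ℕ → V → Role) : ℕ → V → Option V
  | 0 => fun _ => none
  | t + 1 => stepPartner G mR mA (partnerAfter δ t) (δ (t + 1))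

theorem matchRounds_partner [Fintype V] (C : ℝ) (x : ℕ → V → ℝ) (t : ℕ) :
    (matchRounds G C mR mA x t).partner =
      partnerAfter G mR mA (fun t v => drawRole (rate C (Fintype.card V) t) (x t v)) t := by
  induction t with
  | zero => rfl
  | succ t ih =>
    funext v
    simp only [matchRounds, matchRound_partner, partnerAfter, stepPartner, chooseRole_eq_playedRole, ih]

open Classical in
theorem matchRounds_energy_le [Fintype V] (C : ℝ) (x : ℕ → V → ℝ) (t : ℕ) (v : V) :
    (matchRounds G C mR mA x t).energy v ≤
      ∑ s ∈ Finset.Icc 1 t,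
        3 * (if drawRole (rate C (Fintype.card V) s) (x s v) = .sleep then 0 else 1) := by
  induction t with
  | zero => simp [matchRounds]
  | succ t ih =>
    rw [Finset.sum_Icc_succ_top (by omega)]
    simp only [matchRounds]
    refine (matchRound_energy_le _ _ _ _).trans (add_le_add ih ?_)
    rw [chooseRole_eq_playedRole]
    split_ifs with h1 h2 h2
    · simp
    · simp
    · rw [h2, playedRole_sleep] at h1
      exact absurd rfl h1
    · simp

variable {G mR mA}

theorem partnerAfter_congr {δ δ' : ℕ → V → Role} {t : ℕ}
    (h : ∀ s, 1 ≤ s → s ≤ t → δ s = δ' s) :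
    partnerAfter G mR mA δ t = partnerAfter G mR mA δ' t := by
  induction t with
  | zero => rfl
  | succ t ih =>
    have ih := ih fun s h1 h2 => h s h1 (by omega)
    funext v
    simp only [partnerAfter, ih, h (t + 1) (by omega) le_rfl]

theorem partnerAfter_spec {δ : ℕ → V → Role} {t : ℕ} {v w : V}
    (h : partnerAfter G mR mA δ t v = some w) :
    G.Adj v w ∧ partnerAfter G mR mA δ t w = some v ∧
      (mR v = true ∧ mA w = true ∨ mA v = true ∧ mR w = true) := by
  induction t generalizing v w with
  | zero => simp [partnerAfter] at h
  | succ t ih =>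
    simp only [partnerAfter, stepPartner] at h ⊢
    set ρ : V → Role := fun u => playedRole (mR u) (mA u) (partnerAfter G mR mA δ t u) (δ (t + 1) u)
      with hρ
    rcases hr : roundPartner G ρ v with _ | w'
    · rw [hr, Option.none_or] at h
      obtain ⟨h1, h2, h3⟩ := ih h
      refine ⟨h1, ?_, h3⟩
      -- A node that already has a partner plays sleep and so cannot acquire another; this keeps the
      -- old pair symmetric.
      rcases hw : roundPartner G ρ w with _ | z
      · simpa using h2
      · rcases roundPartner_role hw with h' | h'
        · simp [hρ, playedRole_eq_recruit, h2] at h'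
        · simp [hρ, playedRole_eq_accept, h2] at h'
    · rw [hr, Option.some_or] at h
      obtain rfl := Option.some.inj h
      refine ⟨roundPartner_adj hr, by rw [roundPartner_symm hr, Option.some_or], ?_⟩
      rcases roundPartner_role hr with h' | h' <;>
        simp only [hρ, playedRole_eq_recruit, playedRole_eq_accept] at h'
      · exact .inl ⟨h'.1.2.1, h'.2.2.1⟩
      · exact .inr ⟨h'.1.2.1, h'.2.2.1⟩

theorem stepPartner_eq_none {p : V → Option V} {ρ : V → Role} {v : V}
    (h : stepPartner G mR mA p ρ v = none) : p v = none := by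
  simp only [stepPartner, Option.or_eq_none_iff] at h
  exact h.2

theorem partnerAfter_eq_none_of_le {δ : ℕ → V → Role} {s t : ℕ} (hst : s ≤ t) {v : V}
    (h : partnerAfter G mR mA δ t v = none) : partnerAfter G mR mA δ s v = none := by
  induction t, hst using Nat.le_induction with
  | base => exact h
  | succ t _ ih => exact ih (stepPartner_eq_none h)

/-- An edge whose endpoints play complementary roles without competition is matched. -/
theorem stepPartner_of_isolated {p : V → Option V} {ρ : V → Role} {u w : V} (hadj : G.Adj u w)
    (hu : p u = none) (hw : p w = none) (hmu : mR u = true) (hmw : mA w = true)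
    (hρu : ρ u = .recruit) (hρw : ρ w = .accept)
    (hua : ∀ z, G.Adj u z → mA z = true → p z = none → z ≠ w → ρ z = .sleep)
    (hwr : ∀ z, G.Adj w z → mR z = true → p z = none → z ≠ u → ρ z = .sleep) :
    stepPartner G mR mA p ρ u ≠ none ∧ stepPartner G mR mA p ρ w ≠ none := by
  have := roundPartner_of_isolated (G := G)
    (role := fun u => playedRole (mR u) (mA u) (p u) (ρ u)) hadj
    (playedRole_eq_recruit.2 ⟨hu, hmu, hρu⟩) (playedRole_eq_accept.2 ⟨hw, hmw, hρw⟩)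
    (fun z hz hza => by
      obtain ⟨h1, h2, h3⟩ := playedRole_eq_accept.1 hza
      by_contra hne
      rw [hua z hz h2 h1 hne] at h3
      cases h3)
    (fun z hz hza => by
      obtain ⟨h1, h2, h3⟩ := playedRole_eq_recruit.1 hza
      by_contra hne
      rw [hwr z hz h2 h1 hne] at h3
      cases h3)
  simp [stepPartner, this.1, this.2]

end Matching

/-! ### The assignment as a function of the sampled roles -/

section Assign

variable {V : Type*} [DecidableEq V] (G : SimpleGraph V)

/-- The assignment after the runs `0, …, k`, each of `T` rounds, in which the nodes sampled the
roles `δ`. -/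
noncomputable def assignAfter (T : ℕ) (δ : ℕ → ℕ → V → Role) : ℕ → V → Option V
  | 0 => partnerAfter G (fun _ => true) (fun _ => true) (δ 0) T
  | i + 1 => fun v =>
    (partnerAfter G (fun u => (assignAfter T δ i u).isNone) (fun u => (assignAfter T δ i u).isSome)
      (δ (i + 1)) T v).or (assignAfter T δ i v)

theorem nafAlg_assign [Fintype V] (C : ℝ) (x : ℕ → ℕ → V → ℝ) (k : ℕ) :
    (nafAlg G C x k).assign =
      assignAfter G ⌊tMax C (Fintype.card V)⌋₊
        (fun i t v => drawRole (rate C (Fintype.card V) t) (x i t v)) k := by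
  induction k with
  | zero =>
    funext v
    simp [nafAlg, NAFState.update, matchingAlg, matchRounds_partner, assignAfter]
  | succ k ih =>
    funext v
    simp [nafAlg, NAFState.update, matchingAlg, matchRounds_partner, assignAfter, ih]

open Classical in
theorem nafAlg_energy_le [Fintype V] (C : ℝ) (x : ℕ → ℕ → V → ℝ) (k : ℕ) (v : V) :
    (nafAlg G C x k).energy v ≤
      ∑ i ∈ Finset.range (k + 1), ∑ t ∈ Finset.Icc 1 ⌊tMax C (Fintype.card V)⌋₊,
        3 * (if drawRole (rate C (Fintype.card V) t) (x i t v) = .sleep then 0 else 1) := by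
  induction k with
  | zero =>
    simpa [nafAlg, NAFState.update, matchingAlg] using
      matchRounds_energy_le G (fun _ => true) (fun _ => true) C (x 0) _ v
  | succ k ih =>
    rw [Finset.sum_range_succ]
    simp only [nafAlg, NAFState.update, matchingAlg]
    exact add_le_add ih (matchRounds_energy_le _ _ _ _ _ _ _)

/-- The run with the given restrictions and sampled roles leaves no edge that it could add. -/
def IsMaximalRun (mR mA : V → Bool) (T : ℕ) (δ : ℕ → V → Role) : Prop :=
  ∀ u w, G.Adj u w → mR u = true → mA w = true → partnerAfter G mR mA δ T u = none →
    partnerAfter G mR mA δ T w ≠ none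

variable {G} {T : ℕ} {δ : ℕ → ℕ → V → Role}

theorem assignAfter_congr {δ' : ℕ → ℕ → V → Role} {k : ℕ}
    (h : ∀ i ≤ k, ∀ t, 1 ≤ t → t ≤ T → δ i t = δ' i t) :
    assignAfter G T δ k = assignAfter G T δ' k := by
  induction k with
  | zero => exact partnerAfter_congr (h 0 le_rfl)
  | succ k ih =>
    have ih := ih fun i hi => h i (by omega)
    funext v
    simp only [assignAfter, ih]
    rw [partnerAfter_congr (h (k + 1) le_rfl)]

theorem assignAfter_adj {k : ℕ} {v w : V} (h : assignAfter G T δ k v = some w) : G.Adj v w := by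
  induction k with
  | zero => exact (partnerAfter_spec h).1
  | succ k ih =>
    rw [assignAfter, Option.or_eq_some_iff] at h
    rcases h with h | ⟨-, h⟩
    · exact (partnerAfter_spec h).1
    · exact ih h

theorem assignAfter_eq_none_of_le {i k : ℕ} (hik : i ≤ k) {v : V}
    (h : assignAfter G T δ k v = none) : assignAfter G T δ i v = none := by
  induction k, hik using Nat.le_induction with
  | base => exact h
  | succ t _ ih =>
    rw [assignAfter, Option.or_eq_none_iff] at h
    exact ih h.2

theorem card_partnerAfter_eq_le [Fintype V] {mR mA : V → Bool} {ε : ℕ → V → Role} (w : V) :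
    (Finset.univ.filter fun v => partnerAfter G mR mA ε T v = some w).card ≤ 1 := by
  rw [Finset.card_le_one]
  intro a ha b hb
  have ha := (partnerAfter_spec (Finset.mem_filter.1 ha).2).2.1
  have hb := (partnerAfter_spec (Finset.mem_filter.1 hb).2).2.1
  exact Option.some.inj (ha.symm.trans hb)

/-- Each of the `k + 1` runs is a matching, so it contributes at most one node assigned to `w`;
reassignment can only remove others. -/
theorem card_assignAfter_eq_le [Fintype V] (k : ℕ) (w : V) :
    (Finset.univ.filter fun v => assignAfter G T δ k v = some w).card ≤ k + 1 := by
  induction k with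
  | zero => exact card_partnerAfter_eq_le w
  | succ k ih =>
    refine (Finset.card_le_card (t := (Finset.univ.filter fun v =>
      assignAfter G T δ k v = some w) ∪ Finset.univ.filter fun v =>
      partnerAfter G (fun u => (assignAfter G T δ k u).isNone)
        (fun u => (assignAfter G T δ k u).isSome) (δ (k + 1)) T v = some w) ?_).trans
      ((Finset.card_union_le _ _).trans (add_le_add ih (card_partnerAfter_eq_le w)))
    intro v hv
    simp only [assignAfter, Finset.mem_filter, Finset.mem_univ, true_and, Option.or_eq_some_iff,
      Finset.mem_union] at hv ⊢
    tauto

/-- All runs up to the run `K` leave no edge that they could add. -/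
def AllMaximal (G : SimpleGraph V) (T : ℕ) (δ : ℕ → ℕ → V → Role) (K : ℕ) : Prop :=
  IsMaximalRun G (fun _ => true) (fun _ => true) T (δ 0) ∧
    ∀ i < K, IsMaximalRun G (fun u => (assignAfter G T δ i u).isNone)
      (fun u => (assignAfter G T δ i u).isSome) T (δ (i + 1))

/-- The nodes that are unassigned after the run `i`. -/
noncomputable def unassigned [Fintype V] (G : SimpleGraph V) (T : ℕ) (δ : ℕ → ℕ → V → Role)
    (i : ℕ) : Finset V :=
  Finset.univ.filter fun v => assignAfter G T δ i v = none

/-- With `M` the nodes newly assigned in run `i + 1`, the claim amounts to |unassigned| ≤ (load +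
1)·|M|. A node `v` left over is charged to the partner `u` in `M` of `f v`, and `u` is charged at
most `load f` times because its partner is a single node. -/
theorem card_unassigned_succ [Fintype V] {f : V → V} (hf : IsNAF G f) {K i : ℕ}
    (hmax : AllMaximal G T δ K) (hi : i < K) :
    (unassigned G T δ i).card + (load f + 1) * (unassigned G T δ (i + 1)).card ≤
      (load f + 1) * (unassigned G T δ i).card := by
  set p := partnerAfter G (fun u => (assignAfter G T δ i u).isNone)
      (fun u => (assignAfter G T δ i u).isSome) (δ (i + 1)) T with hp
  set M := (unassigned G T δ i).filter fun v => p v ≠ none with hM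
  have hsucc : unassigned G T δ (i + 1) = (unassigned G T δ i).filter fun v => p v = none := by
    ext v
    simp only [unassigned, assignAfter, Finset.mem_filter, Finset.mem_univ, true_and,
      Option.or_eq_none_iff, ← hp]
    tauto
  have hcard : (unassigned G T δ (i + 1)).card + M.card = (unassigned G T δ i).card := by
    rw [hsucc, hM]
    exact Finset.card_filter_add_card_filter_not _
  have hcov : unassigned G T δ i ⊆
      M ∪ M.biUnion fun u => Finset.univ.filter fun v => p u = some (f v) := by
    intro v hv
    have hv0 : assignAfter G T δ i v = none := (Finset.mem_filter.1 hv).2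
    rw [Finset.mem_union]
    by_cases hpv : p v = none
    swap
    · exact .inl (Finset.mem_filter.2 ⟨hv, hpv⟩)
    right
    -- Maximality of run 0 is used here: the unassigned nodes form an independent set from then on.
    have hfv : assignAfter G T δ i (f v) ≠ none := fun h0 =>
      hmax.1 v (f v) (hf v) rfl rfl (assignAfter_eq_none_of_le (Nat.zero_le i) hv0)
        (assignAfter_eq_none_of_le (Nat.zero_le i) h0)
    have hpf := hmax.2 i hi v (f v) (hf v) (by simp [hv0])
      (by simpa [Option.isSome_iff_ne_none] using hfv) hpv
    obtain ⟨u, hu⟩ := Option.ne_none_iff_exists'.1 hpf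
    obtain ⟨-, hu', hmask⟩ := partnerAfter_spec hu
    have hu0 : assignAfter G T δ i u = none := by
      rcases hmask with h | h
      · simp at h
        exact absurd h.1 hfv
      · simpa using h.2
    rw [Finset.mem_biUnion]
    refine ⟨u, Finset.mem_filter.2 ⟨Finset.mem_filter.2 ⟨Finset.mem_univ _, hu0⟩, ?_⟩,
      Finset.mem_filter.2 ⟨Finset.mem_univ _, hu'⟩⟩
    rw [hp, hu']; simp
  have hfib : ∀ u ∈ M, (Finset.univ.filter fun v => p u = some (f v)).card ≤ load f := by
    intro u _
    rcases h : p u with _ | w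
    · simp
    · refine le_trans (le_of_eq ?_) (Finset.le_sup (f := fun w =>
        (Finset.univ.filter fun v => f v = w).card) (Finset.mem_univ w))
      congr 1
      ext v
      simp [eq_comm]
  have h1 : (unassigned G T δ i).card ≤ (load f + 1) * M.card := by
    calc _ ≤ _ := Finset.card_le_card hcov
      _ ≤ M.card + M.card * load f := (Finset.card_union_le _ _).trans
          (Nat.add_le_add_left (Finset.card_biUnion_le_card_mul _ _ _ hfib) _)
      _ = _ := by ring
  rw [← hcard] at h1 ⊢
  nlinarith

theorem one_le_load [Fintype V] (f : V → V) (v : V) : 1 ≤ load f :=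
  (Finset.card_pos (s := Finset.univ.filter fun u => f u = f v).2
    ⟨v, Finset.mem_filter.2 ⟨Finset.mem_univ v, rfl⟩⟩).trans_le
    (Finset.le_sup (f := fun w => (Finset.univ.filter fun v => f v = w).card)
      (Finset.mem_univ (f v)))

theorem load_le_card [Fintype V] (f : V → V) : load f ≤ Fintype.card V :=
  Finset.sup_le fun _ _ => Finset.card_le_univ _

theorem card_unassigned_le [Fintype V] {f : V → V} (hf : IsNAF G f) (hL : 1 ≤ load f) {K i : ℕ}
    (hmax : AllMaximal G T δ K) (hi : i ≤ K) :
    ((unassigned G T δ i).card : ℝ) ≤ Fintype.card V * (1 - 1 / (2 * load f)) ^ i := by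
  have hL' : (1 : ℝ) ≤ load f := by exact_mod_cast hL
  induction i with
  | zero =>
    simpa using Finset.card_le_univ _
  | succ i ih =>
    have h1 := card_unassigned_succ hf hmax (Nat.lt_of_succ_le hi)
    have h1 : ((unassigned G T δ i).card : ℝ) + (load f + 1) * (unassigned G T δ (i + 1)).card ≤
      (load f + 1) * (unassigned G T δ i).card := by exact_mod_cast h1
    have h2 : ((unassigned G T δ (i + 1)).card : ℝ) ≤
        (unassigned G T δ i).card * (1 - 1 / (2 * load f)) := by
      have h3 : ((unassigned G T δ (i + 1)).card : ℝ) ≤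
          (unassigned G T δ i).card * (1 - 1 / (load f + 1)) := by
        have : (1 : ℝ) - 1 / (load f + 1) = load f / (load f + 1) := by field_simp; ring
        rw [this, mul_div_assoc', le_div_iff₀ (by positivity)]
        linarith
      refine h3.trans (mul_le_mul_of_nonneg_left ?_ (Nat.cast_nonneg _))
      -- `load f + 1 ≤ 2 * load f`, as the load is at least 1.
      have : 1 / (2 * (load f : ℝ)) ≤ 1 / (load f + 1) :=
        one_div_le_one_div_of_le (by positivity) (by linarith)
      linarith
    have h0 : (0 : ℝ) ≤ 1 - 1 / (2 * load f) := by
      rw [sub_nonneg, div_le_one (by positivity)]; linarith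
    calc _ ≤ _ := h2
      _ ≤ _ := mul_le_mul_of_nonneg_right (ih (by omega)) h0
      _ = _ := by ring

/-- `2 L log n` maximal runs assign all nodes. -/
theorem assignAfter_ne_none_of_allMaximal [Fintype V] {f : V → V} (hf : IsNAF G f) {K k : ℕ}
    (hmax : AllMaximal G T δ K) (hK : 2 * (load f : ℝ) * Real.log (Fintype.card V) ≤ K)
    (hKk : K ≤ k) (hcard : 2 ≤ Fintype.card V) (v : V) : assignAfter G T δ k v ≠ none := by
  intro hv
  have hL := one_le_load f v
  have hL' : (1 : ℝ) ≤ load f := by exact_mod_cast hL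
  have hn : (2 : ℝ) ≤ Fintype.card V := by exact_mod_cast hcard
  have hv := assignAfter_eq_none_of_le hKk hv
  have hpos : (1 : ℝ) ≤ (unassigned G T δ K).card := by
    exact_mod_cast Finset.card_pos.2 ⟨v, Finset.mem_filter.2 ⟨Finset.mem_univ _, hv⟩⟩
  have hlog : 0 < Real.log (Fintype.card V) := Real.log_pos (by linarith)
  have hK0 : K ≠ 0 := by
    rintro rfl
    have : 0 < 2 * (load f : ℝ) * Real.log (Fintype.card V) := by positivity
    simp at hK
    linarith
  have hq : (0 : ℝ) ≤ 1 - 1 / (2 * load f) := by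
    rw [sub_nonneg, div_le_one (by positivity)]; linarith
  -- Strictness, which needs `K ≠ 0`, makes the final count less than `n · n⁻¹ = 1`, hence zero.
  have h1 : (1 - 1 / (2 * (load f : ℝ))) ^ K < Real.exp (-(1 / (2 * load f))) ^ K := by
    refine pow_lt_pow_left₀ ?_ hq hK0
    have : -(1 / (2 * (load f : ℝ))) ≠ 0 := by
      have : 0 < 1 / (2 * (load f : ℝ)) := by positivity
      linarith
    have := Real.add_one_lt_exp this
    linarith
  have h2 : Real.exp (-(1 / (2 * (load f : ℝ)))) ^ K ≤ (Fintype.card V : ℝ)⁻¹ := by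
    rw [← Real.exp_nat_mul, ← Real.exp_log (show (0 : ℝ) < Fintype.card V by linarith),
      ← Real.exp_neg, Real.exp_le_exp]
    have : Real.log (Fintype.card V) ≤ K * (1 / (2 * (load f : ℝ))) := by
      rw [mul_one_div, le_div_iff₀ (by positivity)]
      linarith
    linarith
  have h3 := card_unassigned_le hf hL hmax le_rfl
  have h4 : (Fintype.card V : ℝ) * (1 - 1 / (2 * (load f : ℝ))) ^ K <
      Fintype.card V * (Fintype.card V : ℝ)⁻¹ :=
    mul_lt_mul_of_pos_left (h1.trans_le h2) (by linarith)
  rw [mul_inv_cancel₀ (by linarith)] at h4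
  linarith

end Assign

/-! ### Independent random roles -/

instance : MeasurableSpace Role := ⊤

instance : DiscreteMeasurableSpace Role := ⟨fun _ => trivial⟩

instance : Finite Role :=
  Finite.of_injective (fun ρ : Role => match ρ with
    | .recruit => (0 : Fin 3)
    | .accept => 1
    | .sleep => 2) (by intro a b h; cases a <;> cases b <;> simp_all)

section Independence

open ProbabilityTheory

open Classical in
-- An event that depends on finitely many roles is pulled back from a finite discrete space, so it
-- is measurable and inherits independence. The value `.sleep` off `S` is an arbitrary filler.
theorem setOf_eq_preimage_restrict {Ω ι : Type*} {X : ι → Ω → Role} {P : (ι → Role) → Prop} {S : Finset ι}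
    (hP : DependsOn P (S : Set ι)) :
    {ω | P fun i => X i ω} = (fun ω (i : S) => X i ω) ⁻¹'
      {y | P fun i => if h : i ∈ S then y ⟨i, h⟩ else .sleep} := by
  ext ω
  simp only [Set.mem_ofPred_eq, Set.mem_preimage]
  rw [hP]
  intro i hi
  simp [Finset.mem_coe.1 hi]

variable {Ω ι : Type*} [MeasurableSpace Ω] {μ : Measure Ω} {X : ι → Ω → Role}

theorem measurableSet_of_dependsOn (hX : ∀ i, Measurable (X i)) {P : (ι → Role) → Prop}
    {S : Finset ι} (hP : DependsOn P (S : Set ι)) : MeasurableSet {ω | P fun i => X i ω} := by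
  rw [setOf_eq_preimage_restrict hP]
  exact measurable_pi_lambda (fun ω (i : S) => X i ω) (fun i => hX i)
    (Set.toFinite _).measurableSet

theorem measureReal_inter_of_dependsOn (hX : ∀ i, Measurable (X i)) (hind : iIndepFun X μ)
    {S T : Finset ι} (hST : Disjoint S T) {P Q : (ι → Role) → Prop}
    (hP : DependsOn P (S : Set ι)) (hQ : DependsOn Q (T : Set ι)) :
    μ.real {ω | (P fun i => X i ω) ∧ Q fun i => X i ω} =
      μ.real {ω | P fun i => X i ω} * μ.real {ω | Q fun i => X i ω} := by
  rw [Set.ofPred_and, setOf_eq_preimage_restrict hP, setOf_eq_preimage_restrict hQ, measureReal_def,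
    (hind.indepFun_finset S T hST hX).measure_inter_preimage_eq_mul _ _
      (Set.toFinite _).measurableSet (Set.toFinite _).measurableSet, ENNReal.toReal_mul]
  rfl

/-- If the event `W a` has probability at most `q` for every value `a ∈ A` of an independent random
variable `F`, then so has `W F` conditionally on `F ∈ A`. -/
theorem measureReal_le_of_forall_value [IsProbabilityMeasure μ] (hX : ∀ i, Measurable (X i))
    (hind : iIndepFun X μ) {S T : Finset ι} (hST : Disjoint S T) {α : Type*} [Finite α]
    {F : (ι → Role) → α} (hF : DependsOn F (S : Set ι)) (A : Set α) {W : α → (ι → Role) → Prop}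
    (hW : ∀ a, DependsOn (W a) (T : Set ι)) {q : ℝ}
    (hq : ∀ a ∈ A, μ.real {ω | W a fun i => X i ω} ≤ q) :
    μ.real {ω | (F fun i => X i ω) ∈ A ∧ W (F fun i => X i ω) fun i => X i ω} ≤
      q * μ.real {ω | (F fun i => X i ω) ∈ A} := by
  classical
  have := Fintype.ofFinite α
  have hFa : ∀ a, DependsOn (fun δ => F δ = a) (S : Set ι) := fun a x y h => by
    simp only [hF h]
  have h1 : {ω | (F fun i => X i ω) ∈ A ∧ W (F fun i => X i ω) fun i => X i ω} ⊆
      ⋃ a ∈ Finset.univ.filter (· ∈ A), {ω | (F fun i => X i ω) = a ∧ W a fun i => X i ω} := by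
    rintro ω ⟨h, h'⟩
    simp only [Finset.mem_filter, Finset.mem_univ, true_and, Set.mem_iUnion]
    exact ⟨_, h, rfl, h'⟩
  have h2 : {ω | (F fun i => X i ω) ∈ A} =
      ⋃ a ∈ Finset.univ.filter (· ∈ A), {ω | (F fun i => X i ω) = a} := by
    ext ω; simp
  calc _ ≤ _ := measureReal_mono h1 (measure_ne_top _ _)
    _ ≤ ∑ a ∈ Finset.univ.filter (· ∈ A),
        μ.real {ω | (F fun i => X i ω) = a ∧ W a fun i => X i ω} := measureReal_biUnion_finset_le _ _
    _ ≤ ∑ a ∈ Finset.univ.filter (· ∈ A), q * μ.real {ω | (F fun i => X i ω) = a} := by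
      refine Finset.sum_le_sum fun a ha => ?_
      rw [measureReal_inter_of_dependsOn hX hind hST (hFa a) (hW a), mul_comm]
      exact mul_le_mul_of_nonneg_right (hq a (Finset.mem_filter.1 ha).2) measureReal_nonneg
    _ = _ := by
      rw [← Finset.mul_sum, h2, measureReal_biUnion_finset]
      · intro a _ b _ hab
        rw [Function.onFun, Set.disjoint_left]
        rintro ω rfl h
        exact hab h
      · exact fun a _ => measurableSet_of_dependsOn hX (hFa a)

/-- Probability that two given nodes recruit and accept, respectively, and some others sleep. -/
theorem le_measureReal_roles (hind : iIndepFun X μ) {r : ℝ}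
    (hr0 : 0 ≤ r) (hr1 : r ≤ 1) {S : Finset ι}
    (hrec : ∀ i, μ.real {ω | X i ω = .recruit} = r / 2)
    (hacc : ∀ i, μ.real {ω | X i ω = .accept} = r / 2)
    (hsl : ∀ i, μ.real {ω | X i ω = .sleep} = 1 - r) {u w : ι} (huw : u ≠ w) {m : ℕ}
    (hm : S.card ≤ m) :
    (r / 2) ^ 2 * (1 - r) ^ m ≤
      μ.real {ω | X u ω = .recruit ∧ X w ω = .accept ∧
        ∀ z ∈ S, z ≠ u → z ≠ w → X z ω = .sleep} := by
  classical
  have := hind.isProbabilityMeasure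
  set S' := (S.erase u).erase w with hS'
  set R : Finset ι := insert u (insert w S') with hR
  have hw' : w ∉ S' := by simp [hS']
  have hu' : u ∉ insert w S' := by simp [hS', huw]
  set s : ι → Set Role := fun z => if z = u then {.recruit} else if z = w then {.accept} else {.sleep}
    with hs
  have hset : {ω | X u ω = .recruit ∧ X w ω = .accept ∧
        ∀ z ∈ S, z ≠ u → z ≠ w → X z ω = .sleep} = ⋂ z ∈ R, X z ⁻¹' s z := by
    ext ω
    simp only [hR, hS', hs, Set.mem_ofPred_eq, Finset.mem_insert, Finset.mem_erase, Set.mem_iInter,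
      Set.mem_preimage]
    constructor
    · rintro ⟨h1, h2, h3⟩ z hz
      split_ifs with hzu hzw
      · simp [hzu, h1]
      · simp [hzw, h2]
      · have : z ∈ S := by tauto
        exact h3 z this hzu hzw
    · intro h
      refine ⟨by simpa using h u (by simp), by simpa [huw.symm] using h w (by simp), ?_⟩
      intro z hz hzu hzw
      simpa [hzu, hzw] using h z (by tauto)
  rw [hset, measureReal_def, iIndepFun.measure_inter_preimage_eq_mul hind R (fun _ _ => trivial),
    ENNReal.toReal_prod, hR, Finset.prod_insert hu', Finset.prod_insert hw']
  have e1 : (μ (X u ⁻¹' s u)).toReal = r / 2 := by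
    rw [← hrec u]; simp [hs, measureReal_def]; rfl
  have e2 : (μ (X w ⁻¹' s w)).toReal = r / 2 := by
    rw [← hacc w]; simp [hs, measureReal_def, huw.symm]; rfl
  have e3 : ∏ z ∈ S', (μ (X z ⁻¹' s z)).toReal = (1 - r) ^ S'.card := by
    rw [← Finset.prod_const]
    refine Finset.prod_congr rfl fun z hz => ?_
    rw [← hsl z]
    simp only [hS', Finset.mem_erase] at hz
    simp [hs, measureReal_def, hz.1, hz.2.1]; rfl
  rw [e1, e2, e3, ← mul_assoc, ← sq]
  refine mul_le_mul_of_nonneg_left (pow_le_pow_of_le_one (by linarith) (by linarith) ?_)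
    (by positivity)
  exact ((Finset.card_erase_le).trans Finset.card_erase_le).trans hm

end Independence

/-! ### Progress of the matching algorithm -/

section Progress

open ProbabilityTheory

variable {V : Type*} [Fintype V] (G : SimpleGraph V) (mR mA : V → Bool)

open Classical in
/-- The neighbors of `v` without a partner that satisfy `m`. -/
noncomputable def openNbrs (m : V → Bool) (p : V → Option V) (v : V) : Finset V :=
  Finset.univ.filter fun z => G.Adj v z ∧ m z = true ∧ p z = none

/-- Every node without a partner has at most `M` neighbors that it could be matched to. -/
def DegreeBound (M : ℝ) (p : V → Option V) : Prop :=
  ∀ v, p v = none → (mR v = true → ((openNbrs G mA p v).card : ℝ) ≤ M) ∧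
    (mA v = true → ((openNbrs G mR p v).card : ℝ) ≤ M)

variable {G mR mA}

theorem mem_openNbrs {m : V → Bool} {p : V → Option V} {v z : V} :
    z ∈ openNbrs G m p v ↔ G.Adj v z ∧ m z = true ∧ p z = none := by
  simp [openNbrs]

theorem openNbrs_subset {m : V → Bool} {p p' : V → Option V}
    (h : ∀ v, p' v = none → p v = none) (v : V) : openNbrs G m p' v ⊆ openNbrs G m p v := by
  intro z hz
  rw [mem_openNbrs] at hz ⊢
  exact ⟨hz.1, hz.2.1, h z hz.2.2⟩

theorem DegreeBound.mono {M : ℝ} {p p' : V → Option V} (h : ∀ v, p' v = none → p v = none)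
    (hp : DegreeBound G mR mA M p) : DegreeBound G mR mA M p' := fun v hv =>
  ⟨fun hm => (Nat.cast_le.2 (Finset.card_le_card (openNbrs_subset h v))).trans
      ((hp v (h v hv)).1 hm),
    fun hm => (Nat.cast_le.2 (Finset.card_le_card (openNbrs_subset h v))).trans
      ((hp v (h v hv)).2 hm)⟩

variable {Ω : Type*} [MeasurableSpace Ω] {μ : Measure Ω}

theorem measureReal_le_one_sub_card_mul [IsProbabilityMeasure μ] {κ : Type*} {N : Finset κ}
    {E : κ → Set Ω} {B : Set Ω} {q : ℝ} (hE : ∀ w ∈ N, MeasurableSet (E w))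
    (hq : ∀ w ∈ N, q ≤ μ.real (E w))
    (hdisj : ∀ w ∈ N, ∀ w' ∈ N, w ≠ w' → Disjoint (E w) (E w'))
    (hB : ∀ w ∈ N, Disjoint (E w) B) : μ.real B ≤ 1 - N.card * q := by
  have h1 : μ.real (⋃ w ∈ N, E w) = ∑ w ∈ N, μ.real (E w) :=
    measureReal_biUnion_finset (fun w hw w' hw' h => hdisj w hw w' hw' h) hE
  have h2 : N.card * q ≤ ∑ w ∈ N, μ.real (E w) := by
    rw [← nsmul_eq_mul]
    exact Finset.card_nsmul_le_sum _ _ _ hq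
  have h3 : B ⊆ (⋃ w ∈ N, E w)ᶜ := by
    intro ω hω hmem
    simp only [Set.mem_iUnion] at hmem
    obtain ⟨w, hw, hwω⟩ := hmem
    exact Set.disjoint_left.1 (hB w hw) hwω hω
  have h4 := measureReal_mono (μ := μ) h3 (measure_ne_top _ _)
  rw [probReal_compl_eq_one_sub (Finset.measurableSet_biUnion _ hE)] at h4
  linarith

/-- The law of the roles sampled in a round with participation rate `r`. -/
structure IsRoundLaw {ι : Type*} (μ : Measure Ω) (X : ι → Ω → Role) (r : ℝ) : Prop where
  recruit : ∀ i, μ.real {ω | X i ω = .recruit} = r / 2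
  accept : ∀ i, μ.real {ω | X i ω = .accept} = r / 2
  sleep : ∀ i, μ.real {ω | X i ω = .sleep} = 1 - r

variable {X : V → Ω → Role} {r : ℝ} {p : V → Option V} {v : V} {m : ℕ}

theorem measurableSet_roles (hX : ∀ i, Measurable (X i)) (P : (V → Role) → Prop) :
    MeasurableSet {ω | P fun i => X i ω} :=
  measurableSet_of_dependsOn (S := Finset.univ) hX fun x y h => by
    rw [show x = y from funext fun i => h i (by simp)]

variable [DecidableEq V]

/-- For each open neighbor `w`, consider the event that `v` recruits, `w` accepts and all their open
competitors sleep. It matches `v`. Events for distinct `w` are disjoint, since each forces the other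
candidate to sleep, so their probabilities add up. -/
theorem measureReal_recruiter_stays_le (hX : ∀ i, Measurable (X i)) (hind : iIndepFun X μ)
    (hr0 : 0 ≤ r) (hr1 : r ≤ 1) (hlaw : IsRoundLaw μ X r) (hv : p v = none) (hm : mR v = true)
    (hcard : ∀ w ∈ openNbrs G mA p v,
      (openNbrs G mA p v).card + (openNbrs G mR p w).card ≤ m) :
    μ.real {ω | stepPartner G mR mA p (fun u => X u ω) v = none} ≤
      1 - (openNbrs G mA p v).card * ((r / 2) ^ 2 * (1 - r) ^ m) := by
  have := hind.isProbabilityMeasure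
  refine measureReal_le_one_sub_card_mul (N := openNbrs G mA p v)
    (E := fun w => {ω | X v ω = .recruit ∧ X w ω = .accept ∧
      ∀ z ∈ openNbrs G mA p v ∪ openNbrs G mR p w, z ≠ v → z ≠ w → X z ω = .sleep}) ?_ ?_ ?_ ?_
  · exact fun w _ => measurableSet_roles hX fun ρ => ρ v = .recruit ∧ ρ w = .accept ∧
      ∀ z ∈ openNbrs G mA p v ∪ openNbrs G mR p w, z ≠ v → z ≠ w → ρ z = .sleep
  · intro w hw
    exact le_measureReal_roles hind hr0 hr1 hlaw.recruit hlaw.accept hlaw.sleep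
      (mem_openNbrs.1 hw).1.ne ((Finset.card_union_le _ _).trans (hcard w hw))
  · intro w hw w' hw' hne
    rw [Set.disjoint_left]
    rintro ω ⟨-, -, h⟩ ⟨-, h', -⟩
    have := h w' (Finset.mem_union_left _ hw') (mem_openNbrs.1 hw').1.ne' hne.symm
    rw [this] at h'
    cases h'
  · intro w hw
    rw [Set.disjoint_left]
    rintro ω ⟨h1, h2, h3⟩ h
    obtain ⟨hadj, hmw, hpw⟩ := mem_openNbrs.1 hw
    refine (stepPartner_of_isolated hadj hv hpw hm hmw h1 h2 ?_ ?_).1 h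
    · exact fun z hz hmz hpz hne =>
        h3 z (Finset.mem_union_left _ (mem_openNbrs.2 ⟨hz, hmz, hpz⟩)) hz.ne' hne
    · exact fun z hz hmz hpz hne =>
        h3 z (Finset.mem_union_right _ (mem_openNbrs.2 ⟨hz, hmz, hpz⟩)) hne hz.ne'

theorem measureReal_accepter_stays_le (hX : ∀ i, Measurable (X i)) (hind : iIndepFun X μ)
    (hr0 : 0 ≤ r) (hr1 : r ≤ 1) (hlaw : IsRoundLaw μ X r) (hv : p v = none) (hm : mA v = true)
    (hcard : ∀ w ∈ openNbrs G mR p v,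
      (openNbrs G mR p v).card + (openNbrs G mA p w).card ≤ m) :
    μ.real {ω | stepPartner G mR mA p (fun u => X u ω) v = none} ≤
      1 - (openNbrs G mR p v).card * ((r / 2) ^ 2 * (1 - r) ^ m) := by
  have := hind.isProbabilityMeasure
  refine measureReal_le_one_sub_card_mul (N := openNbrs G mR p v)
    (E := fun w => {ω | X w ω = .recruit ∧ X v ω = .accept ∧
      ∀ z ∈ openNbrs G mR p v ∪ openNbrs G mA p w, z ≠ w → z ≠ v → X z ω = .sleep}) ?_ ?_ ?_ ?_
  · exact fun w _ => measurableSet_roles hX fun ρ => ρ w = .recruit ∧ ρ v = .accept ∧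
      ∀ z ∈ openNbrs G mR p v ∪ openNbrs G mA p w, z ≠ w → z ≠ v → ρ z = .sleep
  · intro w hw
    exact le_measureReal_roles hind hr0 hr1 hlaw.recruit hlaw.accept hlaw.sleep
      (mem_openNbrs.1 hw).1.ne' ((Finset.card_union_le _ _).trans (hcard w hw))
  · intro w hw w' hw' hne
    rw [Set.disjoint_left]
    rintro ω ⟨-, -, h⟩ ⟨h', -, -⟩
    have := h w' (Finset.mem_union_left _ hw') hne.symm (mem_openNbrs.1 hw').1.ne'
    rw [this] at h'
    cases h'
  · intro w hw
    rw [Set.disjoint_left]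
    rintro ω ⟨h1, h2, h3⟩ h
    obtain ⟨hadj, hmw, hpw⟩ := mem_openNbrs.1 hw
    refine (stepPartner_of_isolated hadj.symm hpw hv hmw hm h1 h2 ?_ ?_).2 h
    · exact fun z hz hmz hpz hne =>
        h3 z (Finset.mem_union_right _ (mem_openNbrs.2 ⟨hz, hmz, hpz⟩)) hz.ne' hne
    · exact fun z hz hmz hpz hne =>
        h3 z (Finset.mem_union_left _ (mem_openNbrs.2 ⟨hz, hmz, hpz⟩)) hne hz.ne'

end Progress

/-! ### Geometric decay over a block of rounds -/

section Decay

open ProbabilityTheory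

variable {V : Type*} [Fintype V] [DecidableEq V] {G : SimpleGraph V} {mR mA : V → Bool}
  {Ω : Type*} [MeasurableSpace Ω] {μ : Measure Ω} {X : ℕ × V → Ω → Role}

theorem dependsOn_partnerAfter (t : ℕ) :
    DependsOn (fun δ : ℕ × V → Role => partnerAfter G mR mA (fun s v => δ (s, v)) t)
      ((Finset.Icc 1 t ×ˢ Finset.univ : Finset (ℕ × V)) : Set (ℕ × V)) := by
  intro x y h
  refine partnerAfter_congr fun s h1 h2 => funext fun v => h (s, v) ?_
  simp [h1, h2]

/-- A condition `R` on the partners that persists backwards in time, and that survives a round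
from a state satisfying `Q` with probability at most `q`, survives `t - t₀` rounds with probability
at most `q ^ (t - t₀)`. -/
theorem measureReal_survives_le (hX : ∀ i, Measurable (X i)) (hind : iIndepFun X μ)
    {Q R : (V → Option V) → Prop} {q : ℝ} (hq : 0 ≤ q) {t₀ t₁ : ℕ}
    (hQ : ∀ p ρ, Q p → Q (stepPartner G mR mA p ρ))
    (hR : ∀ p ρ, R (stepPartner G mR mA p ρ) → R p)
    (hstep : ∀ t, t₀ ≤ t → t < t₁ → ∀ p, Q p → R p →
      μ.real {ω | R (stepPartner G mR mA p fun v => X (t + 1, v) ω)} ≤ q)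
    {t : ℕ} (ht₀ : t₀ ≤ t) (ht : t ≤ t₁) :
    μ.real {ω | Q (partnerAfter G mR mA (fun s v => X (s, v) ω) t₀) ∧
      R (partnerAfter G mR mA (fun s v => X (s, v) ω) t)} ≤ q ^ (t - t₀) := by
  have := hind.isProbabilityMeasure
  induction t, ht₀ using Nat.le_induction with
  | base => simp [measureReal_le_one]
  | succ t ht₀ ih =>
    have ih := ih (by omega)
    have hQ' : ∀ δ : ℕ → V → Role, Q (partnerAfter G mR mA δ t₀) → Q (partnerAfter G mR mA δ t) := by
      intro δ h
      exact Nat.le_induction (P := fun s _ => Q (partnerAfter G mR mA δ s)) h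
        (fun s _ hs => hQ _ _ hs) t ht₀
    set F : (ℕ × V → Role) → (V → Option V) × (V → Option V) := fun δ =>
      (partnerAfter G mR mA (fun s v => δ (s, v)) t₀, partnerAfter G mR mA (fun s v => δ (s, v)) t)
    have hdisj : Disjoint (Finset.Icc 1 t ×ˢ Finset.univ : Finset (ℕ × V))
        ({t + 1} ×ˢ Finset.univ) := by
      rw [Finset.disjoint_left]
      simp only [Finset.mem_product, Finset.mem_Icc, Finset.mem_singleton, Finset.mem_univ]
      omega
    have hF : DependsOn F ((Finset.Icc 1 t ×ˢ Finset.univ : Finset (ℕ × V)) : Set (ℕ × V)) := by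
      intro x y h
      refine Prod.ext ?_ (dependsOn_partnerAfter t h)
      refine dependsOn_partnerAfter t₀ fun i hi => h i ?_
      simp only [Finset.coe_product, Finset.coe_Icc, Finset.coe_univ, Set.mem_prod, Set.mem_Icc,
        Set.mem_univ, and_true] at hi ⊢
      omega
    -- The states at times `t₀` and `t` are determined by the rounds up to `t`, so round `t + 1` is
    -- fresh given their values and contributes one more factor `q`.
    have key := measureReal_le_of_forall_value hX hind hdisj hF {a | Q a.1 ∧ Q a.2 ∧ R a.2}
      (W := fun a δ => R (stepPartner G mR mA a.2 fun v => δ (t + 1, v))) (q := q)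
      (fun a x y h => by
        have : (fun v => x (t + 1, v)) = fun v => y (t + 1, v) := funext fun v => h _ (by simp)
        simp only [this])
      (fun a ha => hstep t ht₀ (by omega) a.2 ha.2.1 ha.2.2)
    refine (measureReal_mono ?_ (measure_ne_top _ _)).trans (key.trans ?_)
    · exact fun ω hω => ⟨⟨hω.1, hQ' _ hω.1, hR _ _ hω.2⟩, hω.2⟩
    · rw [Nat.succ_sub ht₀, pow_succ']
      refine mul_le_mul_of_nonneg_left (le_trans ?_ ih) hq
      refine measureReal_mono ?_ (measure_ne_top _ _)
      exact fun ω hω => ⟨hω.1, hω.2.2⟩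

end Decay

/-! ### The matching algorithm is maximal with high probability -/

/-- The range up to 3/4 is exactly what the rates need: `rate` never exceeds 3/4 by `rate_mem`. -/
theorem exp_neg_three_mul_le {r : ℝ} (h0 : 0 ≤ r) (h1 : r ≤ 3 / 4) : Real.exp (-(3 * r)) ≤ 1 - r := by
  have h := Real.quadratic_le_exp_of_nonneg (x := 3 * r) (by linarith)
  rw [Real.exp_neg, inv_le_comm₀ (Real.exp_pos _) (by linarith)]
  refine le_trans ?_ h
  rw [inv_le_iff_one_le_mul₀ (by linarith)]
  nlinarith [mul_nonneg h0 h0, mul_nonneg h0 (sub_nonneg.2 h1),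
    mul_nonneg (mul_nonneg h0 h0) (sub_nonneg.2 h1)]

/-- A constant that governs the progress in a round. -/
noncomputable def progressConst : ℝ := 9 / 200 * Real.exp (-36)

theorem progressConst_pos : 0 < progressConst := by unfold progressConst; positivity

/-- The three factors of the success probability are bounded below by `d ≥ M/2`, `(r/2)² ≥ 9/(100
M²)` and `(1-r)^m ≥ exp(-3rm) ≥ exp(-36)`, using `m ≤ 2M` and `rM ≤ 6`. Their product is
`progressConst / M`. -/
theorem one_sub_progress_le {M r d : ℝ} {m : ℕ} (hM : 1 ≤ M) (hr0 : 0 ≤ r) (hr1 : r ≤ 3 / 4)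
    (hr : 3 / (5 * M) ≤ r) (hrM : r * M ≤ 6) (hm : (m : ℝ) ≤ 2 * M) (hd : M / 2 ≤ d) :
    1 - d * ((r / 2) ^ 2 * (1 - r) ^ m) ≤ Real.exp (-(progressConst / M)) := by
  have h1 : Real.exp (-36) ≤ (1 - r) ^ m := by
    refine le_trans ?_ (pow_le_pow_left₀ (Real.exp_pos _).le (exp_neg_three_mul_le hr0 hr1) m)
    rw [← Real.exp_nat_mul, Real.exp_le_exp]
    nlinarith
  have h2 : 9 / (100 * M ^ 2) ≤ (r / 2) ^ 2 := by
    have : (3 / (5 * M) / 2) ^ 2 ≤ (r / 2) ^ 2 :=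
      pow_le_pow_left₀ (by positivity) (by linarith) 2
    refine le_trans (le_of_eq ?_) this
    field_simp
    norm_num
  have h3 : progressConst / M ≤ d * ((r / 2) ^ 2 * (1 - r) ^ m) := by
    calc progressConst / M = M / 2 * (9 / (100 * M ^ 2) * Real.exp (-36)) := by
          unfold progressConst; field_simp; norm_num
      _ ≤ _ := by
          have : 0 ≤ d := by linarith
          gcongr
  have := Real.one_sub_le_exp_neg (progressConst / M)
  linarith

/-- The number of rounds after which the degrees are at most `n / 2 ^ j`. -/
noncomputable def phaseTime (C : ℝ) (n j : ℕ) : ℕ :=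
  ⌊tMax C n - n / 2 ^ j * (C * Real.log n)⌋₊

/-! ### Lengths of the phases and rates within them -/

section Phase

variable {C : ℝ} {n j : ℕ}

theorem phaseTime_arg_nonneg (hl : 0 ≤ C * Real.log n) :
    0 ≤ tMax C n - n / 2 ^ j * (C * Real.log n) := by
  have h : (n : ℝ) / 2 ^ j ≤ n := div_le_self (Nat.cast_nonneg _) (one_le_pow₀ (by norm_num))
  have := mul_le_mul_of_nonneg_right h hl
  unfold tMax
  linarith

theorem phaseTime_le (hl : 0 ≤ C * Real.log n) : phaseTime C n j ≤ ⌊tMax C n⌋₊ := by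
  refine Nat.floor_le_floor ?_
  have : 0 ≤ (n : ℝ) / 2 ^ j * (C * Real.log n) := by positivity
  linarith

theorem phaseTime_mono (hl : 0 ≤ C * Real.log n) : phaseTime C n j ≤ phaseTime C n (j + 1) := by
  refine Nat.floor_le_floor ?_
  have : (n : ℝ) / 2 ^ (j + 1) ≤ n / 2 ^ j :=
    div_le_div_of_nonneg_left (Nat.cast_nonneg _) (by positivity)
      (pow_le_pow_right₀ (by norm_num) (Nat.le_succ j))
  have := mul_le_mul_of_nonneg_right this hl
  linarith

/-- With `M = n / 2 ^ j` and `l = C log n`, the unrounded length is `M l / 2`. Rounding costs at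
most 1, which is at most `M l / 4` because `M l ≥ 4`. -/
theorem le_phaseTime_sub (hl : 4 ≤ C * Real.log n) (hM : 1 ≤ (n : ℝ) / 2 ^ j) :
    (n : ℝ) / 2 ^ j * (C * Real.log n) / 4 ≤ (phaseTime C n (j + 1) - phaseTime C n j : ℕ) := by
  rw [Nat.cast_sub (phaseTime_mono (by linarith))]
  have h1 := Nat.lt_floor_add_one (tMax C n - n / 2 ^ (j + 1) * (C * Real.log n))
  have h2 := Nat.floor_le (phaseTime_arg_nonneg (C := C) (n := n) (j := j) (by linarith))
  have h3 : (n : ℝ) / 2 ^ (j + 1) = n / 2 ^ j / 2 := by rw [pow_succ]; field_simp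
  rw [h3] at h1
  unfold phaseTime
  rw [h3]
  nlinarith

theorem rate_mem (hl : 0 < C * Real.log n) {t : ℕ} (ht : t ≤ ⌊tMax C n⌋₊) (hC : 0 ≤ tMax C n) :
    0 ≤ rate C n t ∧ rate C n t ≤ 3 / 4 := by
  have h : (t : ℝ) ≤ tMax C n := (Nat.le_floor_iff hC).1 ht
  unfold rate
  have h4 : 0 < 4 * C * Real.log n + tMax C n - t := by linarith
  refine ⟨div_nonneg (by linarith) h4.le, ?_⟩
  rw [div_le_iff₀ h4]
  linarith

/-- During phase `j` the remaining time lies between `M l / 2` and `M l`, with `M = n / 2 ^ j` and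
`l = C log n`. So the denominator of the rate lies between `M l / 2` and `(M + 4) l ≤ 5 M l`. -/
theorem rate_phase_bounds (hl : 0 < C * Real.log n) (hM : 1 ≤ (n : ℝ) / 2 ^ j) {t : ℕ}
    (h1 : phaseTime C n j ≤ t) (h2 : t < phaseTime C n (j + 1)) :
    3 / (5 * ((n : ℝ) / 2 ^ j)) ≤ rate C n (t + 1) ∧ rate C n (t + 1) * (n / 2 ^ j) ≤ 6 := by
  have h1' : tMax C n - n / 2 ^ j * (C * Real.log n) < (t + 1 : ℕ) := by
    refine (Nat.lt_floor_add_one _).trans_le ?_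
    have h : (phaseTime C n j : ℝ) ≤ t := Nat.cast_le.2 h1
    push_cast
    exact add_le_add h le_rfl
  have h2' := (Nat.le_floor_iff (phaseTime_arg_nonneg (C := C) (n := n) (j := j + 1) hl.le)).1
    (Nat.succ_le_of_lt h2)
  have h3 : (n : ℝ) / 2 ^ (j + 1) = n / 2 ^ j / 2 := by rw [pow_succ]; field_simp
  rw [h3] at h2'
  set M : ℝ := n / 2 ^ j
  set l := C * Real.log n with hl'
  have hMl : l ≤ M * l := le_mul_of_one_le_left hl.le hM
  have h2'' : ((t + 1 : ℕ) : ℝ) ≤ tMax C n - M / 2 * l := h2'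
  have hr : rate C n (t + 1) = 3 * l / (4 * l + tMax C n - (t + 1 : ℕ)) := by
    unfold rate; rw [hl']; ring_nf
  have hden : 0 < 4 * l + tMax C n - (t + 1 : ℕ) := by nlinarith
  rw [hr]
  constructor
  · rw [div_le_div_iff₀ (by positivity) hden]
    nlinarith
  · rw [div_mul_eq_mul_div, div_le_iff₀ hden]
    nlinarith

end Phase

section Maximal

open ProbabilityTheory

variable {V : Type*} [Fintype V] [DecidableEq V] {G : SimpleGraph V} {mR mA : V → Bool}
  {Ω : Type*} [MeasurableSpace Ω] {μ : Measure Ω} {X : ℕ × V → Ω → Role} {C : ℝ}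

/-- In the phase `j`, the degree bound is halved with high probability. -/
theorem measureReal_phase_fails_le (hX : ∀ i, Measurable (X i)) (hind : iIndepFun X μ)
    (hlaw : ∀ t, 1 ≤ t → t ≤ ⌊tMax C (Fintype.card V)⌋₊ →
      IsRoundLaw μ (fun v => X (t, v)) (rate C (Fintype.card V) t))
    (hC : 0 ≤ tMax C (Fintype.card V))
    (hl : 4 ≤ C * Real.log (Fintype.card V)) {j : ℕ} (hM : 1 ≤ (Fintype.card V : ℝ) / 2 ^ j) :
    μ.real {ω |
      DegreeBound G mR mA (Fintype.card V / 2 ^ j)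
        (partnerAfter G mR mA (fun s v => X (s, v) ω) (phaseTime C (Fintype.card V) j)) ∧
      ¬ DegreeBound G mR mA (Fintype.card V / 2 ^ (j + 1))
        (partnerAfter G mR mA (fun s v => X (s, v) ω) (phaseTime C (Fintype.card V) (j + 1)))} ≤
      2 * Fintype.card V *
        Real.exp (-(progressConst / 4 * (C * Real.log (Fintype.card V)))) := by
  have := hind.isProbabilityMeasure
  set n := Fintype.card V
  set M : ℝ := n / 2 ^ j with hMdef
  have hM2 : (n : ℝ) / 2 ^ (j + 1) = M / 2 := by rw [hMdef, pow_succ]; field_simp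
  set e := Real.exp (-(progressConst / 4 * (C * Real.log n))) with he
  set Y : ℕ → Ω → V → Option V := fun t ω => partnerAfter G mR mA (fun s v => X (s, v) ω) t
  -- At least `M l / 4` rounds, with `l = C log n`, each losing `progressConst / M` in the exponent:
  -- `M` cancels, so every phase has the same failure bound.
  have hpow : Real.exp (-(progressConst / M)) ^ (phaseTime C n (j + 1) - phaseTime C n j) ≤ e := by
    rw [← Real.exp_nat_mul, he, Real.exp_le_exp]
    have h1 := le_phaseTime_sub hl hM
    have h2 := mul_le_mul_of_nonneg_right h1
      (div_nonneg progressConst_pos.le (by linarith : (0 : ℝ) ≤ M))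
    have h3 : M * (C * Real.log n) / 4 * (progressConst / M) =
        progressConst / 4 * (C * Real.log n) := by
      have : M ≠ 0 := by linarith
      field_simp
    rw [← hMdef, h3] at h2
    linarith
  have hround : ∀ t, phaseTime C n j ≤ t → t < phaseTime C n (j + 1) → ∀ d : ℝ, M / 2 ≤ d →
      1 - d * ((rate C n (t + 1) / 2) ^ 2 * (1 - rate C n (t + 1)) ^ ⌊2 * M⌋₊) ≤
        Real.exp (-(progressConst / M)) := by
    intro t h1 h2 d hd
    have h3 := rate_phase_bounds (by linarith) hM h1 h2
    have h4 := rate_mem (C := C) (n := n) (by linarith)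
      ((Nat.succ_le_of_lt h2).trans (phaseTime_le (by linarith))) hC
    exact one_sub_progress_le hM h4.1 h4.2 h3.1 h3.2 (Nat.floor_le (by linarith)) hd
  have hQ : ∀ p ρ, DegreeBound G mR mA M p → DegreeBound G mR mA M (stepPartner G mR mA p ρ) :=
    fun p ρ h => h.mono fun v hv => stepPartner_eq_none hv
  have hcast : ∀ a b : ℕ, (a : ℝ) ≤ M → (b : ℝ) ≤ M → a + b ≤ ⌊2 * M⌋₊ := by
    intro a b ha hb
    refine Nat.le_floor ?_
    push_cast
    linarith
  -- Having no partner and at least `M / 2` open neighbors persists backwards in time, so a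
  -- violation at the end of the phase was survived in every round of it.
  have hrec : ∀ v, μ.real {ω | DegreeBound G mR mA M (Y (phaseTime C n j) ω) ∧
      (Y (phaseTime C n (j + 1)) ω v = none ∧ mR v = true ∧
        M / 2 ≤ (openNbrs G mA (Y (phaseTime C n (j + 1)) ω) v).card)} ≤ e := by
    intro v
    refine (measureReal_survives_le (G := G) (mR := mR) (mA := mA) hX hind
      (Q := DegreeBound G mR mA M)
      (R := fun p => p v = none ∧ mR v = true ∧ M / 2 ≤ (openNbrs G mA p v).card)
      (Real.exp_pos (-(progressConst / M))).le hQ ?_ ?_ (phaseTime_mono (by linarith))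
      le_rfl).trans hpow
    · rintro p ρ ⟨h1, h2, h3⟩
      exact ⟨stepPartner_eq_none h1, h2, h3.trans (Nat.cast_le.2
        (Finset.card_le_card (openNbrs_subset (fun _ => stepPartner_eq_none) v)))⟩
    · rintro t h1 h2 p hp ⟨hv, hm, hd⟩
      have ht : t + 1 ≤ ⌊tMax C n⌋₊ := (Nat.succ_le_of_lt h2).trans (phaseTime_le (by linarith))
      have h4 := rate_mem (C := C) (n := n) (by linarith) ht hC
      refine (measureReal_mono (fun ω hω => hω.1) (measure_ne_top _ _)).trans
        ((measureReal_recruiter_stays_le (fun v => hX (t + 1, v))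
          (hind.precomp (Prod.mk_right_injective (t + 1))) h4.1 (by linarith) (hlaw _ (by omega) ht)
          hv hm (m := ⌊2 * M⌋₊) ?_).trans (hround t h1 h2 _ hd))
      intro w hw
      obtain ⟨-, hmw, hpw⟩ := mem_openNbrs.1 hw
      exact hcast _ _ ((hp v hv).1 hm) ((hp w hpw).2 hmw)
  have hacc : ∀ v, μ.real {ω | DegreeBound G mR mA M (Y (phaseTime C n j) ω) ∧
      (Y (phaseTime C n (j + 1)) ω v = none ∧ mA v = true ∧
        M / 2 ≤ (openNbrs G mR (Y (phaseTime C n (j + 1)) ω) v).card)} ≤ e := by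
    intro v
    refine (measureReal_survives_le (G := G) (mR := mR) (mA := mA) hX hind
      (Q := DegreeBound G mR mA M)
      (R := fun p => p v = none ∧ mA v = true ∧ M / 2 ≤ (openNbrs G mR p v).card)
      (Real.exp_pos (-(progressConst / M))).le hQ ?_ ?_ (phaseTime_mono (by linarith))
      le_rfl).trans hpow
    · rintro p ρ ⟨h1, h2, h3⟩
      exact ⟨stepPartner_eq_none h1, h2, h3.trans (Nat.cast_le.2
        (Finset.card_le_card (openNbrs_subset (fun _ => stepPartner_eq_none) v)))⟩
    · rintro t h1 h2 p hp ⟨hv, hm, hd⟩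
      have ht : t + 1 ≤ ⌊tMax C n⌋₊ := (Nat.succ_le_of_lt h2).trans (phaseTime_le (by linarith))
      have h4 := rate_mem (C := C) (n := n) (by linarith) ht hC
      refine (measureReal_mono (fun ω hω => hω.1) (measure_ne_top _ _)).trans
        ((measureReal_accepter_stays_le (fun v => hX (t + 1, v))
          (hind.precomp (Prod.mk_right_injective (t + 1))) h4.1 (by linarith) (hlaw _ (by omega) ht)
          hv hm (m := ⌊2 * M⌋₊) ?_).trans (hround t h1 h2 _ hd))
      intro w hw
      obtain ⟨-, hmw, hpw⟩ := mem_openNbrs.1 hw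
      exact hcast _ _ ((hp v hv).2 hm) ((hp w hpw).1 hmw)
  have hcover : {ω | DegreeBound G mR mA M (Y (phaseTime C n j) ω) ∧
      ¬ DegreeBound G mR mA (n / 2 ^ (j + 1)) (Y (phaseTime C n (j + 1)) ω)} ⊆
      ⋃ v ∈ (Finset.univ : Finset V), ({ω | DegreeBound G mR mA M (Y (phaseTime C n j) ω) ∧
      (Y (phaseTime C n (j + 1)) ω v = none ∧ mR v = true ∧
        M / 2 ≤ (openNbrs G mA (Y (phaseTime C n (j + 1)) ω) v).card)} ∪
      {ω | DegreeBound G mR mA M (Y (phaseTime C n j) ω) ∧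
      (Y (phaseTime C n (j + 1)) ω v = none ∧ mA v = true ∧
        M / 2 ≤ (openNbrs G mR (Y (phaseTime C n (j + 1)) ω) v).card)}) := by
    rintro ω ⟨h1, h2⟩
    rw [hM2, DegreeBound] at h2
    push Not at h2
    obtain ⟨v, hv, h⟩ := h2
    simp only [Finset.mem_univ, Set.iUnion_true, Set.mem_iUnion, Set.mem_union]
    refine ⟨v, ?_⟩
    by_cases hc : mR v = true ∧ M / 2 ≤ (openNbrs G mA (Y (phaseTime C n (j + 1)) ω) v).card
    · exact .inl ⟨h1, hv, hc⟩
    · have h' := h fun hm => (not_le.1 fun h' => hc ⟨hm, h'⟩).le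
      exact .inr ⟨h1, hv, h'.1, h'.2.le⟩
  calc _ ≤ _ := measureReal_mono hcover (measure_ne_top _ _)
    _ ≤ ∑ v : V, μ.real _ := measureReal_biUnion_finset_le _ _
    _ ≤ ∑ v : V, (e + e) := Finset.sum_le_sum fun v _ =>
      (measureReal_union_le _ _).trans (add_le_add (hrec v) (hacc v))
    _ = _ := by
      rw [Finset.sum_const, Finset.card_univ, nsmul_eq_mul]
      ring

theorem measureReal_not_isMaximalRun_le (hX : ∀ i, Measurable (X i)) (hind : iIndepFun X μ)
    (hlaw : ∀ t, 1 ≤ t → t ≤ ⌊tMax C (Fintype.card V)⌋₊ →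
      IsRoundLaw μ (fun v => X (t, v)) (rate C (Fintype.card V) t))
    (hC : 0 ≤ tMax C (Fintype.card V)) (hn : 0 < Fintype.card V)
    (hl : 4 ≤ C * Real.log (Fintype.card V)) :
    μ.real {ω | ¬ IsMaximalRun G mR mA ⌊tMax C (Fintype.card V)⌋₊ fun s v => X (s, v) ω} ≤
      2 * (Fintype.card V : ℝ) ^ 2 *
        Real.exp (-(progressConst / 4 * (C * Real.log (Fintype.card V)))) := by
  have := hind.isProbabilityMeasure
  set n := Fintype.card V with hndef
  set J := Nat.log 2 n with hJ
  have hcover : {ω | ¬ IsMaximalRun G mR mA ⌊tMax C n⌋₊ fun s v => X (s, v) ω} ⊆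
      ⋃ j ∈ Finset.range (J + 1), {ω |
      DegreeBound G mR mA (n / 2 ^ j)
        (partnerAfter G mR mA (fun s v => X (s, v) ω) (phaseTime C n j)) ∧
      ¬ DegreeBound G mR mA (n / 2 ^ (j + 1))
        (partnerAfter G mR mA (fun s v => X (s, v) ω) (phaseTime C n (j + 1)))} := by
    intro ω hω
    by_contra hno
    apply hω
    simp only [Finset.mem_range, Set.mem_iUnion, Set.mem_ofPred_eq, exists_prop, not_exists, not_and,
      not_not] at hno
    have hall : ∀ j ≤ J + 1, DegreeBound G mR mA (n / 2 ^ j)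
        (partnerAfter G mR mA (fun s v => X (s, v) ω) (phaseTime C n j)) := by
      intro j
      induction j with
      | zero =>
        intro _ v _
        rw [pow_zero, div_one]
        exact ⟨fun _ => Nat.cast_le.2 (Finset.card_le_univ _),
          fun _ => Nat.cast_le.2 (Finset.card_le_univ _)⟩
      | succ j ih => exact fun hj => hno j (by omega) (ih (by omega))
    -- Rounds after the last phase can only remove open nodes.
    have hend := (hall (J + 1) le_rfl).mono
      (p' := partnerAfter G mR mA (fun s v => X (s, v) ω) ⌊tMax C n⌋₊)
      fun v hv => partnerAfter_eq_none_of_le (phaseTime_le (by linarith)) hv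
    intro u w hadj hu hw hpu hpw
    have h1 := (hend u hpu).1 hu
    -- A degree bound below 1 means that there is no open neighbor at all.
    have h2 : (n : ℝ) / 2 ^ (J + 1) < 1 := by
      rw [div_lt_one (by positivity)]
      exact_mod_cast Nat.lt_pow_succ_log_self (by norm_num) n
    have h3 : (1 : ℝ) ≤
        (openNbrs G mA (partnerAfter G mR mA (fun s v => X (s, v) ω) ⌊tMax C n⌋₊) u).card := by
      exact_mod_cast Finset.card_pos.2 ⟨w, mem_openNbrs.2 ⟨hadj, hw, hpw⟩⟩
    linarith
  have hJn : J + 1 ≤ n := (Nat.log_lt_self 2 hn.ne')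
  set e := Real.exp (-(progressConst / 4 * (C * Real.log n))) with he
  calc _ ≤ _ := measureReal_mono hcover (measure_ne_top _ _)
    _ ≤ ∑ j ∈ Finset.range (J + 1), μ.real _ := measureReal_biUnion_finset_le _ _
    _ ≤ ∑ j ∈ Finset.range (J + 1), 2 * n * e := by
      refine Finset.sum_le_sum fun j hj => measureReal_phase_fails_le hX hind hlaw hC hl ?_
      rw [one_le_div (by positivity)]
      have : 2 ^ j ≤ n := (Nat.pow_le_pow_right (by norm_num)
        (Nat.lt_succ_iff.1 (Finset.mem_range.1 hj))).trans (Nat.pow_log_le_self 2 hn.ne')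
      exact_mod_cast this
    _ = (J + 1 : ℕ) * (2 * n * e) := by rw [Finset.sum_const, Finset.card_range, nsmul_eq_mul]
    _ ≤ n * (2 * n * e) := mul_le_mul_of_nonneg_right (by exact_mod_cast hJn) (by positivity)
    _ = _ := by ring

end Maximal

/-! ### The runs of the algorithm -/

section Runs

open ProbabilityTheory

variable {V : Type*} [Fintype V] [DecidableEq V] {G : SimpleGraph V}
  {Ω : Type*} [MeasurableSpace Ω] {μ : Measure Ω} {X : ℕ × ℕ × V → Ω → Role} {T : ℕ}

/-- The restrictions of run `i + 1` are a function of runs `0, …, i`, which are independent of its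
samples. So the bound for all fixed restrictions applies to the random ones. -/
theorem measureReal_not_allMaximal_le (hX : ∀ i, Measurable (X i)) (hind : iIndepFun X μ) {ε : ℝ}
    (hrun : ∀ i mR mA, μ.real {ω | ¬ IsMaximalRun G mR mA T fun s v => X (i, s, v) ω} ≤ ε) (K : ℕ) :
    μ.real {ω | ¬ AllMaximal G T (fun i s v => X (i, s, v) ω) K} ≤ (K + 1) * ε := by
  have := hind.isProbabilityMeasure
  have hnext : ∀ i, μ.real {ω | ¬ IsMaximalRun G
      (fun u => (assignAfter G T (fun i s v => X (i, s, v) ω) i u).isNone)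
      (fun u => (assignAfter G T (fun i s v => X (i, s, v) ω) i u).isSome) T
      fun s v => X (i + 1, s, v) ω} ≤ ε := by
    intro i
    have hdisj : Disjoint
        (Finset.range (i + 1) ×ˢ Finset.Icc 1 T ×ˢ Finset.univ : Finset (ℕ × ℕ × V))
        ({i + 1} ×ˢ Finset.Icc 1 T ×ˢ Finset.univ) := by
      rw [Finset.disjoint_left]
      simp only [Finset.mem_product, Finset.mem_range, Finset.mem_singleton]
      omega
    have hF : DependsOn
        (fun δ : ℕ × ℕ × V → Role => assignAfter G T (fun i s v => δ (i, s, v)) i)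
        ((Finset.range (i + 1) ×ˢ Finset.Icc 1 T ×ˢ Finset.univ : Finset (ℕ × ℕ × V)) :
          Set (ℕ × ℕ × V)) := by
      intro x y h
      refine assignAfter_congr fun i' hi' t h1 h2 => funext fun v => h _ ?_
      simp only [Finset.coe_product, Set.mem_prod, Finset.mem_coe, Finset.mem_range, Finset.mem_Icc,
        Finset.mem_univ]
      exact ⟨by omega, ⟨h1, h2⟩, trivial⟩
    have key := measureReal_le_of_forall_value hX hind hdisj hF Set.univ
      (W := fun a δ => ¬ IsMaximalRun G (fun u => (a u).isNone) (fun u => (a u).isSome) T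
        fun s v => δ (i + 1, s, v)) (q := ε) ?_ (fun a _ => hrun _ _ _)
    · simpa using key
    · intro a x y h
      have : partnerAfter G (fun u => (a u).isNone) (fun u => (a u).isSome)
          (fun s v => x (i + 1, s, v)) T = partnerAfter G (fun u => (a u).isNone)
          (fun u => (a u).isSome) (fun s v => y (i + 1, s, v)) T :=
        partnerAfter_congr fun s h1 h2 => funext fun v => h _ (by simp [h1, h2])
      simp only [IsMaximalRun, this]
  have hcover : {ω | ¬ AllMaximal G T (fun i s v => X (i, s, v) ω) K} ⊆
      {ω | ¬ IsMaximalRun G (fun _ => true) (fun _ => true) T fun s v => X (0, s, v) ω} ∪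
      ⋃ i ∈ Finset.range K, {ω | ¬ IsMaximalRun G
        (fun u => (assignAfter G T (fun i s v => X (i, s, v) ω) i u).isNone)
        (fun u => (assignAfter G T (fun i s v => X (i, s, v) ω) i u).isSome) T
        fun s v => X (i + 1, s, v) ω} := by
    intro ω hω
    by_contra hno
    simp only [Set.mem_union, Set.mem_iUnion, Finset.mem_range, Set.mem_ofPred_eq, exists_prop,
      not_or, not_exists, not_and, not_not] at hno
    exact hω hno
  calc _ ≤ _ := measureReal_mono hcover (measure_ne_top _ _)
    _ ≤ _ := measureReal_union_le _ _
    _ ≤ ε + ∑ i ∈ Finset.range K, ε := by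
      refine add_le_add (hrun 0 _ _) ((measureReal_biUnion_finset_le _ _).trans ?_)
      exact Finset.sum_le_sum fun i _ => hnext i
    _ = _ := by rw [Finset.sum_const, Finset.card_range, nsmul_eq_mul]; ring

open Classical in
/-- The number of rounds in which a node is awake has exponential tails. -/
theorem measureReal_awake_ge_le {ι : Type*} {X : ι → Ω → Role} (hX : ∀ i, Measurable (X i))
    (hind : iIndepFun X μ) {r : ι → ℝ} {S : Finset ι}
    (hr : ∀ i ∈ S, μ.real {ω | X i ω = .sleep} = 1 - r i) (hr0 : ∀ i ∈ S, 0 ≤ r i) (a : ℝ) :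
    μ.real {ω | a ≤ ∑ i ∈ S, (if X i ω = .sleep then (0 : ℝ) else 1)} ≤
      Real.exp (2 * ∑ i ∈ S, r i - a) := by
  have := hind.isProbabilityMeasure
  set Z : ι → Ω → ℝ := fun i ω => if X i ω = .sleep then (0 : ℝ) else 1 with hZ
  have hmeas : ∀ i, MeasurableSet {ω | X i ω = .sleep} := fun i =>
    hX i (MeasurableSet.singleton Role.sleep)
  have hZm : ∀ i, Measurable (Z i) := fun i =>
    Measurable.ite (hmeas i) measurable_const measurable_const
  have hZind : iIndepFun Z μ :=
    hind.comp (fun _ ρ => if ρ = .sleep then (0 : ℝ) else 1) (fun _ => measurable_from_top)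
  have hmgf : ∀ i ∈ S, mgf (Z i) μ 1 ≤ Real.exp (2 * r i) := by
    intro i hi
    have h1 : (fun ω => Real.exp (1 * Z i ω)) = fun ω =>
        Real.exp 1 - (Real.exp 1 - 1) * {ω | X i ω = .sleep}.indicator 1 ω := by
      funext ω
      by_cases h : X i ω = .sleep <;> simp [hZ, h]
    rw [mgf, h1, integral_sub (integrable_const _)
      (((integrable_const 1).indicator (hmeas i)).const_mul _), integral_const_mul,
      integral_indicator_one (hmeas i), hr i hi]
    -- The moment generating function at 1 is `1 + (e - 1) r ≤ 1 + 2 r ≤ exp (2 r)`.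
    have h2 := Real.add_one_le_exp (2 * r i)
    have h3 := Real.exp_one_lt_d9
    have h4 := hr0 i hi
    simp only [integral_const, probReal_univ, smul_eq_mul]
    nlinarith
  have hbdd : Integrable (fun ω => Real.exp (1 * (∑ i ∈ S, Z i) ω)) μ := by
    refine Integrable.of_bound (C := Real.exp S.card) (Measurable.aestronglyMeasurable ?_) ?_
    · simp only [Finset.sum_apply]
      exact ((Finset.measurable_sum S fun i _ => hZm i).const_mul 1).exp
    · refine Filter.Eventually.of_forall fun ω => ?_
      rw [Real.norm_of_nonneg (Real.exp_pos _).le, Real.exp_le_exp, one_mul, Finset.sum_apply]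
      calc _ ≤ ∑ i ∈ S, (1 : ℝ) := Finset.sum_le_sum fun i _ => by
            simp only [hZ]; split_ifs <;> norm_num
        _ = _ := by simp
  have h := measure_ge_le_exp_mul_mgf a zero_le_one hbdd
  rw [hZind.mgf_sum hZm] at h
  simp only [Finset.sum_apply] at h
  refine h.trans ?_
  calc _ ≤ Real.exp (-1 * a) * ∏ i ∈ S, Real.exp (2 * r i) :=
        mul_le_mul_of_nonneg_left (Finset.prod_le_prod (fun i _ => mgf_nonneg) hmgf)
          (Real.exp_pos _).le
    _ = _ := by rw [← Real.exp_sum, ← Real.exp_add, Finset.mul_sum]; ring_nf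

end Runs

/-- The rates form a piece of a harmonic series, `3 l / (A - t)` with `l = C log n`, whose
denominators range from about `(n + 4) l` down to about `4 l`. The sum is `l` times O(log n). -/
theorem sum_rate_le {C : ℝ} {n : ℕ} (hn : 2 ≤ n) (hl : 4 ≤ C * Real.log n) :
    ∑ t ∈ Finset.Icc 1 ⌊tMax C n⌋₊, rate C n t ≤ 9 * C * Real.log n ^ 2 := by
  set l := C * Real.log n with hldef
  have hn' : (2 : ℝ) ≤ n := by exact_mod_cast hn
  have hT : tMax C n = n * l := by unfold tMax; ring
  have hT0 : 0 ≤ tMax C n := by rw [hT]; positivity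
  set A := 4 * l + n * l with hA
  have hr : ∀ t : ℕ, rate C n t = 3 * l * (1 / (A - t)) := by
    intro t
    unfold rate
    rw [hT, hA, hldef]
    ring_nf
  have hsum : ∀ s ≤ ⌊tMax C n⌋₊, ∑ t ∈ Finset.Icc 1 s, rate C n t ≤
      3 * l * (Real.log (A - 1) - Real.log (A - s - 1)) := by
    intro s
    induction s with
    | zero => simp
    | succ s ih =>
      intro hs
      rw [Finset.sum_Icc_succ_top (by omega), hr (s + 1)]
      have h1 := ih (by omega)
      have h2 : ((s + 1 : ℕ) : ℝ) ≤ n * l := by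
        rw [← hT]; exact (Nat.le_floor_iff hT0).1 hs
      set x := A - (s + 1 : ℕ) with hx
      have hx16 : 16 ≤ x := by linarith
      have h3 : A - s - 1 = x := by rw [hx]; push_cast; ring
      rw [h3] at h1
      -- This comparison telescopes over the rounds.
      have h4 : 1 / x ≤ Real.log x - Real.log (x - 1) := by
        have h5 := Real.log_le_sub_one_of_pos (x := (x - 1) / x)
          (div_pos (by linarith) (by linarith))
        rw [Real.log_div (by linarith) (by linarith)] at h5
        have h6 : (x - 1) / x = 1 - 1 / x := by
          have : x ≠ 0 := by linarith
          field_simp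
        rw [h6] at h5
        linarith
      have h7 := mul_le_mul_of_nonneg_left h4 (by linarith : 0 ≤ 3 * l)
      linarith
  refine (hsum _ le_rfl).trans ?_
  have h1 : (⌊tMax C n⌋₊ : ℝ) ≤ n * l := by rw [← hT]; exact Nat.floor_le hT0
  have h2 : Real.log l ≤ Real.log (A - ⌊tMax C n⌋₊ - 1) :=
    Real.log_le_log (by linarith) (by linarith)
  have h3 : Real.log (A - 1) ≤ Real.log (n ^ 3 * l) := by
    refine Real.log_le_log (by nlinarith) ?_
    -- The exponent 3 absorbs the summand 4 already at `n = 2`, and gives the factor `3 log n`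
    -- below.
    have : (n : ℝ) + 4 ≤ n ^ 3 := by nlinarith [mul_le_mul hn' hn' (by norm_num) (by linarith)]
    nlinarith
  rw [Real.log_mul (by positivity) (by linarith), Real.log_pow] at h3
  have h4 : Real.log (A - 1) - Real.log (A - ⌊tMax C n⌋₊ - 1) ≤ 3 * Real.log n := by
    push_cast at h3
    linarith
  calc _ ≤ 3 * l * (3 * Real.log n) := mul_le_mul_of_nonneg_left h4 (by linarith)
    _ = _ := by rw [hldef]; ring

/-! ### The roles sampled from the uniform distribution -/

section Sample

open ProbabilityTheory unitInterval

variable {V : Type*}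

/-- The roles that the nodes sample. -/
noncomputable def sampledRole (C : ℝ) (n : ℕ) (p : ℕ × ℕ × V)
    (ω : ℕ × ℕ × V → unitInterval) : Role :=
  drawRole (rate C n p.2.1) (ω p)

theorem measurable_drawRole (r : ℝ) : Measurable fun x : unitInterval => drawRole r x := by
  unfold drawRole
  refine Measurable.ite ?_ measurable_const (Measurable.ite ?_ measurable_const measurable_const)
  · exact measurableSet_le measurable_subtype_coe measurable_const
  · exact measurableSet_le measurable_subtype_coe measurable_const

theorem measurable_sampledRole (C : ℝ) (n : ℕ) (p : ℕ × ℕ × V) :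
    Measurable (sampledRole C n p) :=
  (measurable_drawRole _).comp (measurable_pi_apply p)

instance : IsProbabilityMeasure (sampleLaw V) := by
  unfold sampleLaw; infer_instance

theorem iIndepFun_sampledRole (C : ℝ) (n : ℕ) :
    iIndepFun (sampledRole C n (V := V)) (sampleLaw V) :=
  iIndepFun_infinitePi
    (X := fun (p : ℕ × ℕ × V) (x : unitInterval) => drawRole (rate C n p.2.1) x)
    fun _ => measurable_drawRole _

theorem sampleLaw_real_sampledRole (C : ℝ) (n : ℕ) (p : ℕ × ℕ × V) (ρ : Role) :
    (sampleLaw V).real {ω | sampledRole C n p ω = ρ} =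
      (volume : Measure unitInterval).real {x | drawRole (rate C n p.2.1) x = ρ} := by
  have h : MeasurePreserving (fun ω : ℕ × ℕ × V → unitInterval => ω p) (sampleLaw V) volume :=
    measurePreserving_eval_infinitePi _ p
  exact congrArg ENNReal.toReal (h.measure_preimage
    (measurable_drawRole (rate C n p.2.1) (MeasurableSet.singleton ρ)).nullMeasurableSet)

theorem volume_real_drawRole {r : ℝ} (hr0 : 0 ≤ r) (hr1 : r ≤ 1) :
    (volume : Measure unitInterval).real {x | drawRole r x = .recruit} = r / 2 ∧
    (volume : Measure unitInterval).real {x | drawRole r x = .accept} = r / 2 ∧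
    (volume : Measure unitInterval).real {x | drawRole r x = .sleep} = 1 - r := by
  let a : unitInterval := ⟨r / 2, by linarith, by linarith⟩
  let b : unitInterval := ⟨r, hr0, hr1⟩
  have h1 : {x : unitInterval | drawRole r x = .recruit} = Set.Iic a := by
    ext x
    simp only [drawRole, Set.mem_ofPred_eq, Set.mem_Iic, a, ← Subtype.coe_le_coe]
    split_ifs <;> simp_all
  have h2 : {x : unitInterval | drawRole r x = .accept} = Set.Ioc a b := by
    ext x
    simp only [drawRole, Set.mem_ofPred_eq, Set.mem_Ioc, a, b, ← Subtype.coe_le_coe,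
      ← Subtype.coe_lt_coe]
    split_ifs <;> simp_all
  have h3 : {x : unitInterval | drawRole r x = .sleep} = Set.Ioi b := by
    ext x
    simp only [drawRole, Set.mem_ofPred_eq, Set.mem_Ioi, b, ← Subtype.coe_lt_coe]
    split_ifs <;> simp_all
    linarith
  rw [h1, h2, h3, measureReal_def, measureReal_def, measureReal_def, volume_Iic, volume_Ioc,
    volume_Ioi]
  refine ⟨ENNReal.toReal_ofReal (by simp only [a]; linarith), ?_, ENNReal.toReal_ofReal (by simp only [b]; linarith)⟩
  rw [ENNReal.toReal_ofReal (by simp only [a, b]; linarith)]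
  simp only [a, b]
  ring

theorem isRoundLaw_sampledRole {C : ℝ} {n : ℕ} (i t : ℕ) (hr0 : 0 ≤ rate C n t)
    (hr1 : rate C n t ≤ 1) :
    IsRoundLaw (sampleLaw V) (fun v => sampledRole C n (i, t, v)) (rate C n t) where
  recruit _ := (sampleLaw_real_sampledRole C n _ _).trans (volume_real_drawRole hr0 hr1).1
  accept _ := (sampleLaw_real_sampledRole C n _ _).trans (volume_real_drawRole hr0 hr1).2.1
  sleep _ := (sampleLaw_real_sampledRole C n _ _).trans (volume_real_drawRole hr0 hr1).2.2

end Sample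

/-! ### The main theorem -/

section Main

variable {V : Type*} [Fintype V] [DecidableEq V] (G : SimpleGraph V) (C : ℝ)

theorem nafOutput_assign (k : ℕ) (ω : ℕ × ℕ × V → unitInterval) :
    (nafOutput G C k ω).assign = assignAfter G ⌊tMax C (Fintype.card V)⌋₊
      (fun i t v => sampledRole C (Fintype.card V) (i, t, v) ω) k :=
  nafAlg_assign G C _ k

open Classical in
theorem nafOutput_energy_le (k : ℕ) (ω : ℕ × ℕ × V → unitInterval) (v : V) :
    ((nafOutput G C k ω).energy v : ℝ) ≤
      3 * ∑ p ∈ Finset.range (k + 1) ×ˢ Finset.Icc 1 ⌊tMax C (Fintype.card V)⌋₊ ×ˢ {v},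
        (if sampledRole C (Fintype.card V) p ω = .sleep then (0 : ℝ) else 1) := by
  refine (Nat.cast_le.2 (nafAlg_energy_le G C (fun i t v => (ω (i, t, v) : ℝ)) k v)).trans ?_
  push_cast
  simp only [Finset.sum_product, Finset.sum_singleton, Finset.mul_sum]
  rfl

variable {C}

/-- The probability that one of the first `2 L log n` restricted runs is not maximal. -/
theorem sampleLaw_not_allMaximal_le {L : ℕ} (hn : 2 ≤ Fintype.card V) (hL : L ≤ Fintype.card V)
    (hl : 4 ≤ C * Real.log (Fintype.card V)) {c : ℝ} (hc : c + 7 ≤ progressConst / 4 * C) :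
    (sampleLaw V).real {ω | ¬ AllMaximal G ⌊tMax C (Fintype.card V)⌋₊
      (fun i t v => sampledRole C (Fintype.card V) (i, t, v) ω)
      ⌈2 * (L : ℝ) * Real.log (Fintype.card V)⌉₊} ≤ (Fintype.card V : ℝ) ^ (-(c + 1)) := by
  set n := Fintype.card V
  have hn' : (2 : ℝ) ≤ n := by exact_mod_cast hn
  have hlog : 0 < Real.log n := Real.log_pos (by linarith)
  have hT : 0 ≤ tMax C n := by
    have : tMax C n = n * (C * Real.log n) := by unfold tMax; ring
    rw [this]
    positivity
  have hrun := measureReal_not_allMaximal_le (G := G) (T := ⌊tMax C n⌋₊)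
    (measurable_sampledRole C n) (iIndepFun_sampledRole (V := V) C n)
    (ε := 2 * (n : ℝ) ^ 2 * Real.exp (-(progressConst / 4 * (C * Real.log n))))
    (fun i mR mA => measureReal_not_isMaximalRun_le (X := fun q => sampledRole C n (i, q))
      (fun q => measurable_sampledRole C n _)
      ((iIndepFun_sampledRole (V := V) C n).precomp (Prod.mk_right_injective i))
      (fun t _ h2 => by
        have h := rate_mem (by linarith) h2 hT
        exact isRoundLaw_sampledRole i t h.1 (by linarith [h.2]))
      hT (by omega) hl) ⌈2 * (L : ℝ) * Real.log n⌉₊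
  refine hrun.trans ?_
  have h1 : (⌈2 * (L : ℝ) * Real.log n⌉₊ : ℝ) + 1 ≤ 2 * n ^ 2 := by
    have h2 := Nat.ceil_lt_add_one (show 0 ≤ 2 * (L : ℝ) * Real.log n by positivity)
    have h3 : Real.log n ≤ n - 1 := Real.log_le_sub_one_of_pos (by linarith)
    have h4 : (L : ℝ) ≤ n := by exact_mod_cast hL
    have h5 : (L : ℝ) * Real.log n ≤ n * (n - 1) := mul_le_mul h4 h3 hlog.le (by linarith)
    nlinarith
  have h2 : Real.exp (-(progressConst / 4 * (C * Real.log n))) ≤ (n : ℝ) ^ (-(c + 7)) := by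
    rw [Real.rpow_def_of_pos (by linarith), Real.exp_le_exp]
    have := mul_le_mul_of_nonneg_right hc hlog.le
    linarith
  have h3 : (n : ℝ) ^ (-(c + 1)) = n ^ 6 * (n : ℝ) ^ (-(c + 7)) := by
    rw [← Real.rpow_natCast, ← Real.rpow_add (by linarith)]
    congr 1
    push_cast
    ring
  rw [h3]
  have h4 : (0 : ℝ) ≤ (n : ℝ) ^ (-(c + 7)) := by positivity
  -- The 7 in `c + 7` is spent here: `n²` for the runs, `n²` for nodes and phases, `n²` to absorb
  -- the factor 4, and one power of `n` to spare.
  calc _ ≤ 2 * (n : ℝ) ^ 2 * (2 * n ^ 2 * (n : ℝ) ^ (-(c + 7))) := by gcongr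
    _ = 4 * n ^ 4 * (n : ℝ) ^ (-(c + 7)) := by ring
    _ ≤ _ := by
      refine mul_le_mul_of_nonneg_right ?_ h4
      have : (4 : ℝ) ≤ n ^ 2 := by nlinarith
      calc (4 : ℝ) * n ^ 4 ≤ n ^ 2 * n ^ 4 := by gcongr
        _ = _ := by ring

theorem sampleLaw_energy_gt_le {k : ℕ} (hn : 2 ≤ Fintype.card V)
    (hl : 4 ≤ C * Real.log (Fintype.card V)) {c e : ℝ}
    (he : 3 * (18 * C * (k + 1) * Real.log (Fintype.card V) ^ 2 +
      (c + 2) * Real.log (Fintype.card V)) ≤ e) :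
    (sampleLaw V).real {ω | ∃ v, e < (nafOutput G C k ω).energy v} ≤
      (Fintype.card V : ℝ) ^ (-(c + 1)) := by
  classical
  set n := Fintype.card V with hndef
  have hn' : (2 : ℝ) ≤ n := by exact_mod_cast hn
  have hlog : 0 < Real.log n := Real.log_pos (by linarith)
  have hT : 0 ≤ tMax C n := by
    have : tMax C n = n * (C * Real.log n) := by unfold tMax; ring
    rw [this]
    positivity
  have hv : ∀ v : V, (sampleLaw V).real {ω | e < (nafOutput G C k ω).energy v} ≤
      (n : ℝ) ^ (-(c + 2)) := by
    intro v
    set S : Finset (ℕ × ℕ × V) := Finset.range (k + 1) ×ˢ Finset.Icc 1 ⌊tMax C n⌋₊ ×ˢ {v} with hS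
    have hrate : ∀ p ∈ S, 0 ≤ rate C n p.2.1 ∧ rate C n p.2.1 ≤ 3 / 4 := by
      intro p hp
      simp only [hS, Finset.mem_product, Finset.mem_Icc] at hp
      exact rate_mem (by linarith) hp.2.1.2 hT
    -- The first summand of the assumed bound on `e` is three times twice the expected number of
    -- awake rounds; the second yields `n ^ (-(c + 2))`, one power more than needed for the union
    -- over the nodes.
    have h1 := measureReal_awake_ge_le (measurable_sampledRole C n)
      (iIndepFun_sampledRole (V := V) C n) (r := fun p => rate C n p.2.1) (S := S)
      (fun p hp => (isRoundLaw_sampledRole p.1 p.2.1 (hrate p hp).1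
        (by linarith [(hrate p hp).2])).sleep p.2.2)
      (fun p hp => (hrate p hp).1) (e / 3)
    refine (measureReal_mono ?_ (measure_ne_top _ _)).trans (h1.trans ?_)
    · intro ω hω
      have h2 := nafOutput_energy_le G C k ω v
      have h3 : e < (nafOutput G C k ω).energy v := hω
      change e / 3 ≤ _
      rw [← hndef, ← hS] at h2
      linarith
    · rw [Real.rpow_def_of_pos (by linarith), Real.exp_le_exp]
      have h2 : ∑ p ∈ S, rate C n p.2.1 ≤ (k + 1) * (9 * C * Real.log n ^ 2) := by
        simp only [hS, Finset.sum_product, Finset.sum_const, Finset.card_range,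
          Finset.card_singleton, one_smul, nsmul_eq_mul]
        push_cast
        exact mul_le_mul_of_nonneg_left (sum_rate_le hn hl) (by positivity)
      linarith
  have hcover : {ω | ∃ v, e < ((nafOutput G C k ω).energy v : ℝ)} ⊆
      ⋃ v ∈ (Finset.univ : Finset V), {ω | e < ((nafOutput G C k ω).energy v : ℝ)} := by
    rintro ω ⟨v, hv⟩
    exact Set.mem_biUnion (Finset.mem_coe.2 (Finset.mem_univ v)) hv
  calc _ ≤ _ := measureReal_mono hcover (measure_ne_top _ _)
    _ ≤ ∑ v : V, (sampleLaw V).real _ := measureReal_biUnion_finset_le _ _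
    _ ≤ ∑ v : V, (n : ℝ) ^ (-(c + 2)) := Finset.sum_le_sum fun v _ => hv v
    _ = (n : ℝ) ^ (1 : ℝ) * (n : ℝ) ^ (-(c + 2)) := by
      rw [Finset.sum_const, Finset.card_univ, nsmul_eq_mul, Real.rpow_one]
    _ = _ := by
      rw [← Real.rpow_add (by linarith)]
      congr 1
      ring

/-- A total assignment after `k` restricted runs is a neighbor assignment function of load at most
`k + 1`. -/
theorem exists_naf_of_assign_ne_none {k : ℕ} {ω : ℕ × ℕ × V → unitInterval}
    (h : ∀ v, (nafOutput G C k ω).assign v ≠ none) :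
    ∃ f : V → V, (∀ v, (nafOutput G C k ω).assign v = some (f v)) ∧ IsNAF G f ∧
      load f ≤ k + 1 := by
  choose f hf using fun v => Option.ne_none_iff_exists'.1 (h v)
  refine ⟨f, hf, fun v => ?_, Finset.sup_le fun w _ => ?_⟩
  · have := hf v
    rw [nafOutput_assign] at this
    exact assignAfter_adj this
  · refine le_trans (le_of_eq ?_) (card_assignAfter_eq_le (G := G)
      (T := ⌊tMax C (Fintype.card V)⌋₊)
      (δ := fun i t v => sampledRole C (Fintype.card V) (i, t, v) ω) k w)
    congr 1
    ext v
    have := hf v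
    rw [nafOutput_assign] at this
    simp [this]

end Main

theorem theorem3 :
    ∃ d : ℕ, ∀ c : ℝ, 0 < c → ∃ C₀ : ℝ, 0 < C₀ ∧ ∀ C : ℝ, C₀ ≤ C → ∀ b : ℝ, ∃ B : ℝ,
      ∀ (V : Type*) [Fintype V] [DecidableEq V] (G : SimpleGraph V) (L k : ℕ),
        (∃ f : V → V, IsNAF G f ∧ load f = L) →
        2 * (L : ℝ) * Real.log (Fintype.card V) ≤ (k : ℝ) →
        (k : ℝ) ≤ b * L * Real.log (Fintype.card V) →
        1 - (Fintype.card V : ℝ) ^ (-c) ≤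
          (sampleLaw V).real {ω |
            (∃ f : V → V, (∀ v, (nafOutput G C k ω).assign v = some (f v)) ∧ IsNAF G f ∧
              (load f : ℝ) ≤ B * L * Real.log (Fintype.card V)) ∧
            ∀ v, ((nafOutput G C k ω).energy v : ℝ) ≤
              B * L * Real.log (Fintype.card V) ^ d} := by
  -- The constant 8 ensures `C log n ≥ 4`, since `log n ≥ 1/2` for `n ≥ 2`. The other term of the
  -- maximum makes the failure probability of a run small enough. In `B`, the summands pay for the
  -- expected energy and for its deviation.
  refine ⟨3, fun c hc => ⟨max 8 ((c + 7) / (progressConst / 4)), by positivity, fun C hC b =>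
    ⟨3 * (18 * C * (b + 2) + 4 * (c + 2)), ?_⟩⟩⟩
  intro V _ _ G L k ⟨f, hf, hL⟩ hk hkb
  have hC8 : 8 ≤ C := (le_max_left _ _).trans hC
  have hCc : c + 7 ≤ progressConst / 4 * C := by
    have := (le_max_right _ _).trans hC
    rwa [div_le_iff₀' (by have := progressConst_pos; positivity)] at this
  rcases isEmpty_or_nonempty V with hV | ⟨⟨v₀⟩⟩
  · have huniv : {ω | (∃ f : V → V, (∀ v, (nafOutput G C k ω).assign v = some (f v)) ∧ IsNAF G f ∧
        (load f : ℝ) ≤ 3 * (18 * C * (b + 2) + 4 * (c + 2)) * L * Real.log (Fintype.card V)) ∧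
        ∀ v, ((nafOutput G C k ω).energy v : ℝ) ≤ 3 * (18 * C * (b + 2) + 4 * (c + 2)) * L *
          Real.log (Fintype.card V) ^ 3} = Set.univ :=
      Set.eq_univ_of_forall fun ω =>
        ⟨⟨f, fun v => hV.elim v, hf, by simp [load]⟩, fun v => hV.elim v⟩
    rw [huniv, probReal_univ]
    have : (0 : ℝ) ≤ (Fintype.card V : ℝ) ^ (-c) := by positivity
    linarith
  have hn : 2 ≤ Fintype.card V :=
    Fintype.one_lt_card_iff.2 ⟨v₀, f v₀, (hf v₀).ne⟩
  have hn' : (2 : ℝ) ≤ Fintype.card V := by exact_mod_cast hn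
  have hlog : 1 / 2 ≤ Real.log (Fintype.card V) := by
    have h1 := Real.log_two_gt_d9
    have h2 := Real.log_le_log (by norm_num) hn'
    linarith
  have hL1 : (1 : ℝ) ≤ L := by exact_mod_cast hL ▸ one_le_load f v₀
  have hl : 4 ≤ C * Real.log (Fintype.card V) := by nlinarith
  set n := Fintype.card V
  set x := Real.log n
  have hLx : 0 < (L : ℝ) * x := by positivity
  -- The two bounds on `k` are contradictory for smaller `b`.
  have hb : 2 ≤ b := by
    by_contra hb
    nlinarith
  -- `1 ≤ 2 L x`, because `L ≥ 1` and `x ≥ 1/2`.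
  have hk1 : (k : ℝ) + 1 ≤ (b + 2) * (L * x) := by nlinarith
  set B := 3 * (18 * C * (b + 2) + 4 * (c + 2)) with hB
  set e := B * L * x ^ 3 with hedef
  have he : 3 * (18 * C * (k + 1) * x ^ 2 + (c + 2) * x) ≤ e := by
    have h1 : 18 * C * (k + 1) * x ^ 2 ≤ 18 * C * ((b + 2) * (L * x)) * x ^ 2 := by gcongr
    have h2 : x ≤ 4 * (L * x ^ 3) := by
      have h3 : 1 ≤ 4 * x ^ 2 := by nlinarith
      have h4 : 1 ≤ L * (4 * x ^ 2) := one_le_mul_of_one_le_of_one_le hL1 h3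
      nlinarith
    have h3 : (c + 2) * x ≤ (c + 2) * (4 * (L * x ^ 3)) := by gcongr
    rw [hedef, hB]
    linarith
  set good := {ω | (∃ f : V → V, (∀ v, (nafOutput G C k ω).assign v = some (f v)) ∧ IsNAF G f ∧
    (load f : ℝ) ≤ B * L * x) ∧ ∀ v, ((nafOutput G C k ω).energy v : ℝ) ≤ e} with hgood
  -- Covering the whole space needs only subadditivity, so measurability of `good` plays no role.
  -- Maximality is asked only of run 0 and the first `⌈2 L log n⌉` restricted runs, as later runs
  -- never unassign a node.
  have hcover : (Set.univ : Set (ℕ × ℕ × V → unitInterval)) ⊆ good ∪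
      ({ω | ¬ AllMaximal G ⌊tMax C n⌋₊ (fun i t v => sampledRole C n (i, t, v) ω)
        ⌈2 * (L : ℝ) * x⌉₊} ∪ {ω | ∃ v, e < (nafOutput G C k ω).energy v}) := by
    intro ω _
    by_cases h1 : AllMaximal G ⌊tMax C n⌋₊ (fun i t v => sampledRole C n (i, t, v) ω)
        ⌈2 * (L : ℝ) * x⌉₊
    swap
    · exact .inr (.inl h1)
    by_cases h2 : ∃ v, e < (nafOutput G C k ω).energy v
    · exact .inr (.inr h2)
    left
    push Not at h2
    refine ⟨?_, h2⟩
    obtain ⟨g, hg1, hg2, hg3⟩ := exists_naf_of_assign_ne_none G (C := C) (k := k) (ω := ω)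
      (fun v => by
        rw [nafOutput_assign]
        exact assignAfter_ne_none_of_allMaximal hf h1 (by rw [hL]; exact Nat.le_ceil _)
          (Nat.ceil_le.2 hk) hn v)
    refine ⟨g, hg1, hg2, ?_⟩
    have h3 : (load g : ℝ) ≤ k + 1 := by exact_mod_cast hg3
    have h4 : b + 2 ≤ B := by rw [hB]; nlinarith
    have h5 := mul_le_mul_of_nonneg_right h4 hLx.le
    linarith
  have h1 := measureReal_mono (μ := sampleLaw V) hcover (measure_ne_top _ _)
  rw [probReal_univ] at h1
  have h2 := measureReal_union_le (μ := sampleLaw V) good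
    ({ω | ¬ AllMaximal G ⌊tMax C n⌋₊ (fun i t v => sampledRole C n (i, t, v) ω)
        ⌈2 * (L : ℝ) * x⌉₊} ∪ {ω | ∃ v, e < (nafOutput G C k ω).energy v})
  have h3 := measureReal_union_le (μ := sampleLaw V)
    {ω | ¬ AllMaximal G ⌊tMax C n⌋₊ (fun i t v => sampledRole C n (i, t, v) ω)
        ⌈2 * (L : ℝ) * x⌉₊} {ω | ∃ v, e < ((nafOutput G C k ω).energy v : ℝ)}
  have h4 := sampleLaw_not_allMaximal_le G (L := L) hn (hL ▸ load_le_card f) hl hCc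
  have h5 := sampleLaw_energy_gt_le G (k := k) hn hl he
  have h6 : 2 * (n : ℝ) ^ (-(c + 1)) ≤ (n : ℝ) ^ (-c) := by
    have h7 : (n : ℝ) ^ (-c) = n * (n : ℝ) ^ (-(c + 1)) := by
      rw [← Real.rpow_one_add' (by linarith) (by linarith)]
      congr 1
      ring
    rw [h7]
    exact mul_le_mul_of_nonneg_right hn' (by positivity)
  linarith
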